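/- For a probability law $P$ on $\mathbb R$ with $\int|x|^3\,dP(x)<\infty$, let $\mu(P)$ denote its mean and $\sigma(P)$ its standard deviation. If $\sigma(P)>0$, let $\widetilde P$ be its standardization, that is, the image of $P$ under $x\mapsto (x-\mu(P))/\sigma(P)$, and let $\varrho(P)=\int|x|^3\,d\widetilde P(x)\ (\ge 1)$. For $\varrho\ge1$ put $$B(\varrho)=\sqrt{\tfrac12\varrho^2+\tfrac12\varrho\sqrt{\varrho^2+8}-2}.$$ For probability laws $P,Q$ on $\mathbb R$ let $$\zeta_3(P,Q)=\sup_f\left|\int f\,dP-\int f\,dQ\right|\in[0,\infty]$$ be the Zolotarev distance of order $3$, where the supremum is over all bounded $f\in C^2(\mathbb R,\mathbb R)$ with $|f''(x)-f''(y)|\le|x-y|$ for all $x,y\in\mathbb R$. **Theorem.** Let $n\ge1$ and let $P_1,\dots,P_n$ be probability laws on $\mathbb R$ with $\int|x|^3\,dP_i(x)<\infty$ and $\sigma_i=\sigma(P_i)>0$. Put $\varrho_i=\varrho(P_i)$, $\sigma=\bigl(\sum_{i=1}^n\sigma_i^2\bigr)^{1/2}$ and $Q_i=\tfrac12(\delta_{-\sigma_i}+\delta_{\sigma_i})$.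 Then $$\zeta_3\Bigl(\widetilde{P_1*\cdots*P_n}\,,\ \widetilde{Q_1*\cdots*Q_n}\Bigr)\ \le\ \frac1{6\sigma^3}\sum_{i=1}^n\sigma_i^3B(\varrho_i).$$ Equality holds whenever each $P_i$ is a two-point law (i.e. $P_i=p\,\delta_a+(1-p)\,\delta_b$ with $a\ne b$, $0<p<1$, where $a,b,p$ may depend on $i$) and the centred third moments $\int(x-\mu(P_i))^3\,dP_i(x)$ are all $\ge0$ or all $\le0$. -/

import Mathlib

open MeasureTheory

noncomputable section

namespace Zolotarev

/-- The mean `μ(P)`. -/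
def mean (P : Measure ℝ) : ℝ := ∫ x, x ∂P

/-- The standard deviation `σ(P)`. -/
def stdDev (P : Measure ℝ) : ℝ := √(ProbabilityTheory.variance id P)

/-- The class of laws with finite third absolute moment and strictly positive standard deviation. -/
structure MemP3 (P : Measure ℝ) : Prop where
  isProbabilityMeasure : IsProbabilityMeasure P
  integrable_abs_pow_three : Integrable (fun x : ℝ => |x| ^ 3) P
  stdDev_pos : 0 < stdDev P

/-- The standardization of `P`: its image under `x ↦ (x - μ(P)) / σ(P)`. -/
def standardize (P : Measure ℝ) : Measure ℝ :=
  P.map (fun x => (x - mean P) / stdDev P)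

/-- The standardized third absolute moment `ρ(P)`. -/
def rho (P : Measure ℝ) : ℝ := ∫ x, |x| ^ 3 ∂(standardize P)

/-- The third centred moment. -/
def centredThirdMoment (P : Measure ℝ) : ℝ := ∫ x, (x - mean P) ^ 3 ∂P

/-- The function `B(ρ)`, used for `ρ ≥ 1`, where the radicand is nonnegative. -/
def B (ρ : ℝ) : ℝ := √(ρ ^ 2 / 2 + ρ * √(ρ ^ 2 + 8) / 2 - 2)

/-- The convolution `P₀ ∗ (P₁ ∗ (⋯ ∗ Pₙ₋₁))`; the empty convolution is the point mass at `0`. -/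
def convFin : (n : ℕ) → (Fin n → Measure ℝ) → Measure ℝ
  | 0, _ => Measure.dirac 0
  | n + 1, P => Measure.conv (P 0) (convFin n (fun i => P i.succ))

/-- The symmetric law `(δ_{-s} + δ_s) / 2`. -/
def symmTwoPoint (s : ℝ) : Measure ℝ :=
  (2⁻¹ : ENNReal) • (Measure.dirac (-s) + Measure.dirac s)

/-- `P` is a two-point law: it charges exactly two distinct points. -/
def IsTwoPoint (P : Measure ℝ) : Prop :=
  ∃ a b p : ℝ, a ≠ b ∧ 0 < p ∧ p < 1 ∧
    P = ENNReal.ofReal p • Measure.dirac a + ENNReal.ofReal (1 - p) • Measure.dirac b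

/-- The bounded `C²` functions `f : ℝ → ℝ` whose second derivative is Lipschitz with constant at
most `1`. -/
def F3Bdd : Set (ℝ → ℝ) :=
  {f | ContDiff ℝ 2 f ∧ LipschitzWith 1 (iteratedDeriv 2 f) ∧ ∃ C : ℝ, ∀ x, |f x| ≤ C}

/-- The Zolotarev distance of order `3` between laws on the line, with values in `[0, ∞]`. -/
def zeta3 (P Q : Measure ℝ) : ENNReal :=
  ⨆ f ∈ F3Bdd, ENNReal.ofReal |(∫ x, f x ∂P) - ∫ x, f x ∂Q|

end Zolotarev

end

open Zolotarev

/-!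
For standardized `X ∼ P` and `Y ∼ Q` put `K(s) = E (X - s)₊² - E (Y - s)₊²`. Taylor's formula and
Fubini's theorem give `E f(X) - E f(Y) = ½ ∫ f‴ K`, so that `ζ₃(P, Q) ≤ ½ ∫ |K|`. If `K` changes
sign only once, at `t`, then taking `f = |· - t|³` shows
`½ ∫ |K| = (E |X - t|³ - E |Y - t|³) / 6`.

Let `Y = ±1` with equal probabilities. On `[-1, 1]` the function `K` has a concave derivative, and
`K ≤ 0` to the left of this interval, `K ≥ 0` to the right of it. Hence `K` changes sign only once,
at some `t ∈ [-1, 1]`, and `E |Y - t|³ = 1 + 3 t²`. It remains to show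
`E |X - t|³ ≤ 1 + 3 t² + B(E |X|³)`; this follows by integrating an inequality between `|x - t|³`,
`|x|³` and a parabola that is an equality at the two atoms of the extremal law of `X`.

Since `ζ₃` is subadditive under convolution and homogeneous of degree three, the bound for sums
follows from the case `n = 1`. Conversely, the functions `-sin(ε x) / ε³` belong to the class
defining `ζ₃` and, up to a linear term, tend to `x³ / 6`, so `ζ₃` is at least one sixth of the
difference of the third moments. For two-point laws with third centred moments of one sign these
bounds coincide.
-/

namespace Zolotarev

noncomputable section

/-! ### The function `B` -/

lemma B_sub_two_div {R : ℝ} (hR : 0 < R) : B (R - 2 / R) = √(R ^ 2 - 4) := by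
  have h : √((R - 2 / R) ^ 2 + 8) = R + 2 / R := by
    rw [Real.sqrt_eq_iff_mul_self_eq (by positivity) (by positivity)]
    field_simp
    ring
  rw [B, h]
  congr 1
  field_simp
  ring

lemma B_mono : MonotoneOn B (Set.Ici 0) := by
  intro a (ha : 0 ≤ a) b _ hab
  unfold B
  gcongr

lemma exists_inv_sub_eq {b : ℝ} (hb : 0 < b) : ∃ c : ℝ, 0 < c ∧ c < 1 ∧ 1 / c - c = b := by
  have hs : √(b ^ 2 + 4) ^ 2 = b ^ 2 + 4 := Real.sq_sqrt (by positivity)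
  have hlt : b < √(b ^ 2 + 4) := Real.lt_sqrt_of_sq_lt (by linarith)
  have hlt' : √(b ^ 2 + 4) < b + 2 := (Real.sqrt_lt' (by linarith)).2 (by nlinarith)
  refine ⟨(√(b ^ 2 + 4) - b) / 2, by linarith, by linarith, ?_⟩
  have : √(b ^ 2 + 4) - b ≠ 0 := by linarith
  field_simp
  linear_combination -hs

/-- The argument of `B` is the third absolute moment of the centred two-point law of unit variance
with atoms `-1 / c` and `c`. -/
lemma B_inv_sub_add {c : ℝ} (hc : 0 < c) (hc1 : c ≤ 1) :
    B (1 / c - c + 2 * c ^ 3 / (1 + c ^ 2)) = 1 / c - c := by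
  have hR : 1 / c - c + 2 * c ^ 3 / (1 + c ^ 2) = (c + 1 / c) - 2 / (c + 1 / c) := by
    field_simp
    ring
  have hsq : (c + 1 / c) ^ 2 - 4 = (1 / c - c) ^ 2 := by
    field_simp
    ring
  have : c ≤ 1 / c := by rw [le_div_iff₀ hc]; nlinarith
  rw [hR, B_sub_two_div (by positivity), hsq, Real.sqrt_sq (by linarith)]

/-! ### Moments of convolutions -/

section ThirdMoment

variable {μ ν : Measure ℝ} [IsProbabilityMeasure μ] [IsProbabilityMeasure ν]

lemma memLp_sub (hμ : MemLp id 3 μ) (a : ℝ) : MemLp (fun x => x - a) 3 μ :=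
  hμ.sub (memLp_const a)

lemma integrable_abs_sub_pow (hμ : MemLp id 3 μ) (a : ℝ) {k : ℕ} (hk : k ≤ 3) :
    Integrable (fun x => |x - a| ^ k) μ :=
  ((memLp_sub hμ a).mono_exponent (by exact_mod_cast hk)).integrable_norm_pow'

lemma integrable_sub_pow (hμ : MemLp id 3 μ) (a : ℝ) {k : ℕ} (hk : k ≤ 3) :
    Integrable (fun x => (x - a) ^ k) μ :=
  (integrable_abs_sub_pow hμ a hk).mono (by fun_prop) (by simp)

lemma memLp_id_conv (hμ : MemLp id 3 μ) (hν : MemLp id 3 ν) : MemLp id 3 (μ.conv ν) := by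
  rw [Measure.conv, memLp_map_measure_iff (by fun_prop) (by fun_prop)]
  exact (hμ.comp_fst ν).add (hν.comp_snd μ)

lemma integral_sub_pow_conv (hμ : MemLp id 3 μ) (hν : MemLp id 3 ν) (a b : ℝ) {k : ℕ}
    (hk : k ≤ 3) :
    ∫ x, (x - (a + b)) ^ k ∂(μ.conv ν) = ∑ j ∈ Finset.range (k + 1),
      (∫ x, (x - a) ^ j ∂μ) * (∫ y, (y - b) ^ (k - j) ∂ν) * k.choose j := by
  rw [Measure.conv, integral_map (by fun_prop) (by fun_prop)]
  have hexp : ∀ p : ℝ × ℝ, (p.1 + p.2 - (a + b)) ^ k =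
      ∑ j ∈ Finset.range (k + 1), (p.1 - a) ^ j * (p.2 - b) ^ (k - j) * k.choose j := fun p => by
    rw [add_sub_add_comm, add_pow]
  simp_rw [hexp]
  rw [integral_finsetSum]
  · exact Finset.sum_congr rfl fun j _ => by
      rw [integral_mul_const, integral_prod_mul (fun x => (x - a) ^ j) fun y => (y - b) ^ (k - j)]
  · intro j hj
    have hj : j ≤ k := by simpa [Nat.lt_succ_iff] using hj
    exact ((integrable_sub_pow hμ a (hj.trans hk)).mul_prod
      (integrable_sub_pow hν b ((Nat.sub_le k j).trans hk))).mul_const _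

lemma integral_sub_mean (hμ : MemLp id 3 μ) : ∫ x, (x - mean μ) ∂μ = 0 := by
  have hid : Integrable (fun x => x) μ := by
    simpa using integrable_sub_pow hμ 0 (k := 1) (by norm_num)
  simp [integral_sub hid (integrable_const _), mean]

lemma mean_conv (hμ : MemLp id 3 μ) (hν : MemLp id 3 ν) :
    mean (μ.conv ν) = mean μ + mean ν := by
  have h := integral_sub_pow_conv hμ hν 0 0 (k := 1) (by norm_num)
  simpa [mean, Finset.sum_range_succ, add_comm] using h

lemma stdDev_sq (P : Measure ℝ) : stdDev P ^ 2 = ∫ x, (x - mean P) ^ 2 ∂P := by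
  rw [stdDev, Real.sq_sqrt (ProbabilityTheory.variance_nonneg _ _),
    ProbabilityTheory.variance_eq_integral aemeasurable_id]
  rfl

lemma integral_sq (hμ : MemLp id 3 μ) : ∫ x, x ^ 2 ∂μ = stdDev μ ^ 2 + mean μ ^ 2 := by
  have h := ProbabilityTheory.variance_eq_sub (hμ.mono_exponent (p := 2) (by norm_num))
  rw [stdDev, Real.sq_sqrt (ProbabilityTheory.variance_nonneg _ _), h, mean]
  simp

lemma integrable_quadratic (hμ : MemLp id 3 μ) (a b c : ℝ) :
    Integrable (fun x => a + b * x + c * x ^ 2) μ := by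
  have hid : Integrable (fun x => b * x) μ := by
    simpa using (integrable_sub_pow hμ 0 (k := 1) (by norm_num)).const_mul b
  have hsq : Integrable (fun x => c * x ^ 2) μ := by
    simpa using (integrable_sub_pow hμ 0 (k := 2) (by norm_num)).const_mul c
  exact ((integrable_const a).add hid).add hsq

lemma integral_quadratic (hμ : MemLp id 3 μ) (a b c : ℝ) :
    ∫ x, (a + b * x + c * x ^ 2) ∂μ = a + b * mean μ + c * (stdDev μ ^ 2 + mean μ ^ 2) := by
  have hlin : Integrable (fun x => a + b * x) μ := by simpa using integrable_quadratic hμ a b 0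
  have hid : Integrable (fun x => b * x) μ := by simpa using integrable_quadratic hμ 0 b 0
  have hsq : Integrable (fun x => c * x ^ 2) μ := by simpa using integrable_quadratic hμ 0 0 c
  rw [integral_add hlin hsq, integral_add (integrable_const a) hid, integral_const_mul,
    integral_const_mul, integral_sq hμ, mean]
  simp

lemma stdDev_sq_conv (hμ : MemLp id 3 μ) (hν : MemLp id 3 ν) :
    stdDev (μ.conv ν) ^ 2 = stdDev μ ^ 2 + stdDev ν ^ 2 := by
  rw [stdDev_sq, mean_conv hμ hν, integral_sub_pow_conv hμ hν _ _ (by norm_num)]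
  simp [Finset.sum_range_succ, integral_sub_mean hμ, integral_sub_mean hν, stdDev_sq, add_comm]

lemma centredThirdMoment_conv (hμ : MemLp id 3 μ) (hν : MemLp id 3 ν) :
    centredThirdMoment (μ.conv ν) = centredThirdMoment μ + centredThirdMoment ν := by
  rw [centredThirdMoment, mean_conv hμ hν, integral_sub_pow_conv hμ hν _ _ le_rfl]
  simp [Finset.sum_range_succ, integral_sub_mean hμ, integral_sub_mean hν, centredThirdMoment,
    add_comm]

end ThirdMoment

section ConvFin

variable {n : ℕ} {P : Fin n → Measure ℝ} [∀ i, IsProbabilityMeasure (P i)]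

instance isProbabilityMeasure_convFin : IsProbabilityMeasure (convFin n P) := by
  induction n with
  | zero => exact Measure.dirac.isProbabilityMeasure
  | succ n ih =>
    have : IsProbabilityMeasure (convFin n fun i => P i.succ) := ih
    rw [convFin]
    infer_instance

lemma memLp_id_convFin (hP : ∀ i, MemLp id 3 (P i)) : MemLp id 3 (convFin n P) := by
  induction n with
  | zero =>
    have : id =ᵐ[Measure.dirac (0 : ℝ)] fun _ => (0 : ℝ) := by
      rw [Filter.EventuallyEq, ae_dirac_eq]
      rfl
    exact (memLp_congr_ae this).2 (memLp_const 0)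
  | succ n ih => exact memLp_id_conv (hP 0) (ih fun i => hP i.succ)

lemma convFin_eq_sum_of_conv_eq_add {Φ : Measure ℝ → ℝ} (h0 : Φ (Measure.dirac 0) = 0)
    (hadd : ∀ μ ν : Measure ℝ, IsProbabilityMeasure μ → IsProbabilityMeasure ν →
      MemLp id 3 μ → MemLp id 3 ν → Φ (μ.conv ν) = Φ μ + Φ ν)
    (hP : ∀ i, MemLp id 3 (P i)) : Φ (convFin n P) = ∑ i, Φ (P i) := by
  induction n with
  | zero => simp [convFin, h0]
  | succ n ih =>
    rw [convFin, hadd _ _ inferInstance inferInstance (hP 0) (memLp_id_convFin fun i => hP i.succ),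
      ih fun i => hP i.succ, Fin.sum_univ_succ]

lemma mean_convFin (hP : ∀ i, MemLp id 3 (P i)) : mean (convFin n P) = ∑ i, mean (P i) :=
  convFin_eq_sum_of_conv_eq_add (by simp [mean]) (fun _ _ _ _ => mean_conv) hP

lemma stdDev_sq_convFin (hP : ∀ i, MemLp id 3 (P i)) :
    stdDev (convFin n P) ^ 2 = ∑ i, stdDev (P i) ^ 2 :=
  convFin_eq_sum_of_conv_eq_add (Φ := fun μ => stdDev μ ^ 2) (by simp [stdDev_sq, mean])
    (fun _ _ _ _ => stdDev_sq_conv) hP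

lemma centredThirdMoment_convFin (hP : ∀ i, MemLp id 3 (P i)) :
    centredThirdMoment (convFin n P) = ∑ i, centredThirdMoment (P i) :=
  convFin_eq_sum_of_conv_eq_add (by simp [centredThirdMoment, mean])
    (fun _ _ _ _ => centredThirdMoment_conv) hP

end ConvFin

/-! ### The stop-loss representation -/

/-- The stop-loss transform of order two of a law, `s ↦ ∫ (x - s)₊² dμ(x)`. -/
def stopLoss (μ : Measure ℝ) (s : ℝ) : ℝ := ∫ x, max (x - s) 0 ^ 2 ∂μ

/-- The Peano kernel of the second-order Taylor expansion at `0`: it is `(x - s)²` for `0 < s ≤ x`,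
`-(x - s)²` for `x < s ≤ 0`, and `0` otherwise. In this form its expectation in `x` is the stop-loss
transform up to a term depending on the first two moments only. -/
def peanoKernel (x s : ℝ) : ℝ := max (x - s) 0 ^ 2 - (Set.Iic 0).indicator (fun r => (x - r) ^ 2) s

lemma measurable_peanoKernel : Measurable (Function.uncurry peanoKernel) :=
  Measurable.sub (by fun_prop) <|
    Measurable.indicator (f := fun p : ℝ × ℝ => (p.1 - p.2) ^ 2) (by fun_prop)
      (measurable_snd measurableSet_Iic)

lemma abs_peanoKernel_le (x s : ℝ) :
    |peanoKernel x s| ≤ (Set.Icc (-|x|) |x|).indicator (fun _ => x ^ 2) s := by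
  have hnonneg : 0 ≤ (Set.Icc (-|x|) |x|).indicator (fun _ => x ^ 2) s :=
    Set.indicator_nonneg (fun _ _ => sq_nonneg x) s
  rcases le_or_gt s 0 with hs | hs <;> rcases le_total s x with hx | hx
  · simpa [peanoKernel, hs, hx] using hnonneg
  · have hmem : s ∈ Set.Icc (-|x|) |x| := ⟨by linarith [neg_abs_le x], by linarith [abs_nonneg x]⟩
    rw [peanoKernel, max_eq_right (sub_nonpos.2 hx), Set.indicator_of_mem (Set.mem_Iic.2 hs),
      Set.indicator_of_mem hmem, zero_pow two_ne_zero, zero_sub, abs_neg, abs_sq]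
    nlinarith
  · have hmem : s ∈ Set.Icc (-|x|) |x| := ⟨by linarith [abs_nonneg x], hx.trans (le_abs_self x)⟩
    rw [peanoKernel, max_eq_left (sub_nonneg.2 hx), Set.indicator_of_notMem (by simpa using hs),
      Set.indicator_of_mem hmem, sub_zero, abs_sq]
    nlinarith
  · simpa [peanoKernel, hs.not_ge, hx] using hnonneg

lemma integral_mul_peanoKernel (φ : ℝ → ℝ) (x : ℝ) :
    ∫ s, φ s * peanoKernel x s = ∫ s in (0)..x, (x - s) ^ 2 * φ s := by
  rcases le_total 0 x with hx | hx
  · rw [intervalIntegral.integral_of_le hx, ← integral_indicator measurableSet_Ioc]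
    refine integral_congr_ae (.of_forall fun s => ?_)
    simp only [peanoKernel, Set.indicator_apply, Set.mem_Iic, Set.mem_Ioc]
    grind
  · rw [intervalIntegral.integral_of_ge hx, ← integral_indicator measurableSet_Ioc, ← integral_neg]
    refine integral_congr_ae (.of_forall fun s => ?_)
    simp only [peanoKernel, Set.indicator_apply, Set.mem_Iic, Set.mem_Ioc]
    grind

section Peano

variable {f f' f'' : ℝ → ℝ} {L : NNReal}

lemma taylor_peanoKernel (hf : ∀ x, HasDerivAt f (f' x) x) (hf' : ∀ x, HasDerivAt f' (f'' x) x)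
    (hL : LipschitzWith L f'') (x : ℝ) :
    f x = f 0 + f' 0 * x + f'' 0 / 2 * x ^ 2 + (∫ s, deriv f'' s * peanoKernel x s) / 2 := by
  have hparts : ∫ s in (0)..x, (x - s) ^ 2 * deriv f'' s =
      -(x ^ 2 * f'' 0) + 2 * ∫ s in (0)..x, (x - s) * f'' s := by
    have hd : ∀ s, deriv (fun s => (x - s) ^ 2) s = -2 * (x - s) := fun s => by
      simpa using (((hasDerivAt_id s).const_sub x).fun_pow 2).deriv
    have hc : AbsolutelyContinuousOnInterval (fun s => (x - s) ^ 2) 0 x :=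
      (by fun_prop : ContDiff ℝ 1 fun s => (x - s) ^ 2).contDiffOn.absolutelyContinuousOnInterval
    rw [hc.integral_mul_deriv_eq_deriv_mul hL.lipschitzOnWith.absolutelyContinuousOnInterval]
    simp only [hd, mul_assoc, intervalIntegral.integral_const_mul]
    ring
  have hftc : ∫ s in (0)..x, (x - s) * f'' s = f x - (f 0 + f' 0 * x) := by
    have hd : ∀ s, HasDerivAt (fun s => f s + f' s * (x - s)) ((x - s) * f'' s) s := fun s => by
      refine ((hf s).add ((hf' s).mul ((hasDerivAt_id s).const_sub x))).congr_deriv ?_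
      simp only [id]
      ring
    rw [intervalIntegral.integral_eq_sub_of_hasDerivAt (fun s _ => hd s)]
    · simp
    · exact (Continuous.mul (by fun_prop) hL.continuous).intervalIntegrable _ _
  rw [integral_mul_peanoKernel, hparts, hftc]
  ring

end Peano

section PeanoLaw

variable {φ : ℝ → ℝ} {C : ℝ}

lemma abs_mul_peanoKernel_le (hC : ∀ s, |φ s| ≤ C) (x s : ℝ) :
    |φ s * peanoKernel x s| ≤ (Set.Icc (-|x|) |x|).indicator (fun _ => C * x ^ 2) s := by
  rw [abs_mul, Set.indicator_const_mul]
  exact mul_le_mul (hC s) (abs_peanoKernel_le x s) (abs_nonneg _) ((abs_nonneg _).trans (hC s))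

lemma integrable_indicator_Icc_abs (a x : ℝ) :
    Integrable ((Set.Icc (-|x|) |x|).indicator fun _ => a) :=
  (integrable_indicator_iff measurableSet_Icc).2 (integrableOn_const (by simp))

lemma integrable_mul_peanoKernel_right (hφ : Measurable φ) (hC : ∀ s, |φ s| ≤ C) (x : ℝ) :
    Integrable (fun s => φ s * peanoKernel x s) :=
  (integrable_indicator_Icc_abs (C * x ^ 2) x).mono'
    (hφ.mul measurable_peanoKernel.of_uncurry_left).aestronglyMeasurable
    (.of_forall (abs_mul_peanoKernel_le hC x))

lemma integral_abs_mul_peanoKernel_le (hφ : Measurable φ) (hC : ∀ s, |φ s| ≤ C) (x : ℝ) :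
    ∫ s, |φ s * peanoKernel x s| ≤ 2 * C * |x| ^ 3 := by
  calc ∫ s, |φ s * peanoKernel x s|
      ≤ ∫ s, (Set.Icc (-|x|) |x|).indicator (fun _ => C * x ^ 2) s :=
        integral_mono (integrable_mul_peanoKernel_right hφ hC x).abs
          (integrable_indicator_Icc_abs _ x) (abs_mul_peanoKernel_le hC x)
    _ = 2 * |x| * (C * x ^ 2) := by
        rw [integral_indicator measurableSet_Icc, setIntegral_const, Real.volume_real_Icc_of_le
          (neg_le_self (abs_nonneg x)), smul_eq_mul]
        ring
    _ = 2 * C * |x| ^ 3 := by rw [← sq_abs x]; ring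

variable {μ ν : Measure ℝ} [IsProbabilityMeasure μ] [IsProbabilityMeasure ν]

lemma integrable_mul_peanoKernel (hφ : Measurable φ) (hC : ∀ s, |φ s| ≤ C) (hμ : MemLp id 3 μ) :
    Integrable (fun p : ℝ × ℝ => φ p.2 * peanoKernel p.1 p.2) (μ.prod volume) := by
  have hmeas : AEStronglyMeasurable (fun p : ℝ × ℝ => φ p.2 * peanoKernel p.1 p.2)
      (μ.prod volume) :=
    ((hφ.comp measurable_snd).mul measurable_peanoKernel).aestronglyMeasurable
  have hcube : Integrable (fun x => 2 * C * |x| ^ 3) μ := by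
    simpa using (integrable_abs_sub_pow hμ 0 le_rfl).const_mul (2 * C)
  refine (integrable_prod_iff hmeas).2
    ⟨.of_forall (integrable_mul_peanoKernel_right hφ hC),
      hcube.mono' hmeas.norm.integral_prod_right' (.of_forall fun x => ?_)⟩
  rw [Real.norm_of_nonneg (integral_nonneg fun s => norm_nonneg _)]
  exact integral_abs_mul_peanoKernel_le hφ hC x

lemma integrable_max_sub_sq (hμ : MemLp id 3 μ) (s : ℝ) :
    Integrable (fun x => max (x - s) 0 ^ 2) μ := by
  refine (integrable_sub_pow hμ s (k := 2) (by norm_num)).mono' (by fun_prop)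
    (.of_forall fun x => ?_)
  rw [Real.norm_of_nonneg (sq_nonneg _), ← sq_abs (x - s)]
  exact pow_le_pow_left₀ (le_max_right _ _) (max_le (le_abs_self _) (abs_nonneg _)) 2

lemma integral_sub_sq (hμ : MemLp id 3 μ) (s : ℝ) :
    ∫ x, (x - s) ^ 2 ∂μ = stdDev μ ^ 2 + (mean μ - s) ^ 2 := by
  calc ∫ x, (x - s) ^ 2 ∂μ = ∫ x, (s ^ 2 + -2 * s * x + 1 * x ^ 2) ∂μ := by
        congr with x
        ring
    _ = stdDev μ ^ 2 + (mean μ - s) ^ 2 := by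
        rw [integral_quadratic hμ]
        ring

lemma integral_peanoKernel (hμ : MemLp id 3 μ) (s : ℝ) :
    ∫ x, peanoKernel x s ∂μ =
      stopLoss μ s - (Set.Iic 0).indicator (fun r => stdDev μ ^ 2 + (mean μ - r) ^ 2) s := by
  by_cases hs : s ∈ Set.Iic 0
  · simp only [peanoKernel, Set.indicator_of_mem hs]
    rw [integral_sub (integrable_max_sub_sq hμ s) (integrable_sub_pow hμ s (by norm_num)),
      integral_sub_sq hμ, stopLoss]
  · simp only [peanoKernel, Set.indicator_of_notMem hs, sub_zero, stopLoss]

lemma integral_peanoKernel_sub (hμ : MemLp id 3 μ) (hν : MemLp id 3 ν) (hmean : mean μ = mean ν)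
    (hsd : stdDev μ = stdDev ν) (s : ℝ) :
    ∫ x, peanoKernel x s ∂μ - ∫ x, peanoKernel x s ∂ν = stopLoss μ s - stopLoss ν s := by
  rw [integral_peanoKernel hμ, integral_peanoKernel hν, hmean, hsd, sub_sub_sub_cancel_right]

lemma integrable_mul_integral_peanoKernel (hφ : Measurable φ) (hC : ∀ s, |φ s| ≤ C)
    (hμ : MemLp id 3 μ) : Integrable fun s => φ s * ∫ x, peanoKernel x s ∂μ := by
  simpa only [integral_const_mul] using (integrable_mul_peanoKernel hφ hC hμ).integral_prod_right

lemma integrable_stopLoss_sub (hμ : MemLp id 3 μ) (hν : MemLp id 3 ν) (hmean : mean μ = mean ν)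
    (hsd : stdDev μ = stdDev ν) : Integrable fun s => stopLoss μ s - stopLoss ν s := by
  have hone : ∀ s : ℝ, |(fun _ => 1 : ℝ → ℝ) s| ≤ 1 := by simp
  have hκ := (integrable_mul_integral_peanoKernel measurable_const hone hμ).sub
    (integrable_mul_integral_peanoKernel measurable_const hone hν)
  simpa [Pi.sub_def, integral_peanoKernel_sub hμ hν hmean hsd] using hκ

variable {f f' f'' : ℝ → ℝ} {L : NNReal}

lemma integral_eq_add_integral_peanoKernel (hf : ∀ x, HasDerivAt f (f' x) x)
    (hf' : ∀ x, HasDerivAt f' (f'' x) x) (hL : LipschitzWith L f'') (hμ : MemLp id 3 μ) :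
    ∫ x, f x ∂μ = f 0 + f' 0 * mean μ + f'' 0 / 2 * (stdDev μ ^ 2 + mean μ ^ 2) +
      (∫ s, deriv f'' s * ∫ x, peanoKernel x s ∂μ) / 2 := by
  have hk := integrable_mul_peanoKernel (measurable_deriv f'')
    (fun s => norm_deriv_le_of_lipschitz hL) hμ
  have hswap : ∫ x, (∫ s, deriv f'' s * peanoKernel x s) ∂μ =
      ∫ s, deriv f'' s * ∫ x, peanoKernel x s ∂μ := by
    simp_rw [← integral_const_mul]
    exact integral_integral_swap (f := fun x s => deriv f'' s * peanoKernel x s) hk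
  rw [integral_congr_ae (.of_forall (taylor_peanoKernel hf hf' hL)),
    integral_add (integrable_quadratic hμ _ _ _) (hk.integral_prod_left.div_const 2),
    integral_quadratic hμ, integral_div, hswap]

lemma integral_sub_integral_eq_stopLoss (hf : ∀ x, HasDerivAt f (f' x) x)
    (hf' : ∀ x, HasDerivAt f' (f'' x) x) (hL : LipschitzWith L f'') (hμ : MemLp id 3 μ)
    (hν : MemLp id 3 ν) (hmean : mean μ = mean ν) (hsd : stdDev μ = stdDev ν) :
    ∫ x, f x ∂μ - ∫ x, f x ∂ν = (∫ s, deriv f'' s * (stopLoss μ s - stopLoss ν s)) / 2 := by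
  have hint := fun {ξ : Measure ℝ} [IsProbabilityMeasure ξ] =>
    integrable_mul_integral_peanoKernel (μ := ξ) (measurable_deriv f'')
      fun s => norm_deriv_le_of_lipschitz hL
  simp_rw [← integral_peanoKernel_sub hμ hν hmean hsd, mul_sub]
  rw [integral_sub (hint hμ) (hint hν), integral_eq_add_integral_peanoKernel hf hf' hL hμ,
    integral_eq_add_integral_peanoKernel hf hf' hL hν, hmean, hsd]
  ring

lemma abs_integral_sub_integral_le_stopLoss (hf : ∀ x, HasDerivAt f (f' x) x)
    (hf' : ∀ x, HasDerivAt f' (f'' x) x) (hL : LipschitzWith 1 f'') (hμ : MemLp id 3 μ)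
    (hν : MemLp id 3 ν) (hmean : mean μ = mean ν) (hsd : stdDev μ = stdDev ν) :
    |∫ x, f x ∂μ - ∫ x, f x ∂ν| ≤ (∫ s, |stopLoss μ s - stopLoss ν s|) / 2 := by
  rw [integral_sub_integral_eq_stopLoss hf hf' hL hμ hν hmean hsd, abs_div, abs_two]
  refine div_le_div_of_nonneg_right ?_ zero_le_two
  refine norm_integral_le_of_norm_le (G := ℝ) (integrable_stopLoss_sub hμ hν hmean hsd).abs
    (.of_forall fun s => ?_)
  rw [norm_mul]
  exact mul_le_of_le_one_left (abs_nonneg _) (by simpa using norm_deriv_le_of_lipschitz hL)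

end PeanoLaw

lemma hasDerivAt_abs_mul_self (y : ℝ) : HasDerivAt (fun y => |y| * y) (2 * |y|) y := by
  rcases eq_or_ne y 0 with rfl | hy
  · rw [hasDerivAt_iff_tendsto_slope_zero]
    refine Filter.Tendsto.congr' (f₁ := fun y => |y|) ?_ ?_
    · filter_upwards [self_mem_nhdsWithin] with y (hy : y ≠ 0)
      simp [mul_comm, hy]
    · simpa using (continuous_abs.tendsto (0 : ℝ)).mono_left nhdsWithin_le_nhds
  · refine ((hasDerivAt_abs hy).mul (hasDerivAt_id y)).congr_deriv ?_
    rcases hy.lt_or_gt with hy | hy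
    · simp only [hy, sign_neg, SignType.coe_neg, SignType.coe_one, abs_of_neg, id]
      ring
    · simp only [hy, sign_pos, SignType.coe_one, abs_of_pos, id]
      ring

lemma hasDerivAt_abs_pow_three (y : ℝ) : HasDerivAt (fun y => |y| ^ 3) (3 * (|y| * y)) y := by
  have hcube : (fun y : ℝ => |y| ^ 3) = fun y => |y| * y * y := by
    funext y
    rw [pow_succ', sq_abs, sq, mul_assoc]
  rw [hcube]
  refine ((hasDerivAt_abs_mul_self y).mul (hasDerivAt_id y)).congr_deriv ?_
  simp only [id]
  ring

lemma hasDerivAt_max_zero_sq (y : ℝ) :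
    HasDerivAt (fun y => max y 0 ^ 2) (2 * max y 0) y := by
  have hmax : ∀ y : ℝ, max y 0 = (y + |y|) / 2 := fun y => by
    rcases le_total 0 y with hy | hy <;> simp [hy, abs_of_nonneg, abs_of_nonpos]
  have hsq : (fun y : ℝ => max y 0 ^ 2) = fun y => (y ^ 2 + |y| * y) / 2 := by
    funext y
    rw [hmax]
    linear_combination sq_abs y / 4
  rw [hsq, hmax]
  refine (((hasDerivAt_pow 2 y).add (hasDerivAt_abs_mul_self y)).div_const 2).congr_deriv ?_
  norm_num
  ring

/-! ### A single sign change -/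

section SingleCrossing

variable {μ ν : Measure ℝ} [IsProbabilityMeasure μ] [IsProbabilityMeasure ν]

lemma integral_abs_stopLoss_sub (hμ : MemLp id 3 μ) (hν : MemLp id 3 ν) (hmean : mean μ = mean ν)
    (hsd : stdDev μ = stdDev ν) {t : ℝ} (hlt : ∀ s < t, stopLoss μ s ≤ stopLoss ν s)
    (hgt : ∀ s > t, stopLoss ν s ≤ stopLoss μ s) :
    ∫ s, |stopLoss μ s - stopLoss ν s| = (∫ x, |x - t| ^ 3 ∂μ - ∫ x, |x - t| ^ 3 ∂ν) / 3 := by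
  have hd : ∀ x, HasDerivAt (fun x => |x - t| ^ 3) (3 * (|x - t| * (x - t))) x := fun x =>
    (hasDerivAt_abs_pow_three (x - t)).comp_sub_const x t
  have hd' : ∀ x, HasDerivAt (fun x => 3 * (|x - t| * (x - t))) (6 * |x - t|) x := fun x =>
    (((hasDerivAt_abs_mul_self (x - t)).comp_sub_const x t).const_mul 3).congr_deriv (by ring)
  have hL : LipschitzWith 6 fun x => 6 * |x - t| := LipschitzWith.of_dist_le_mul fun x y => by
    have := abs_abs_sub_abs_le_abs_sub (x - t) (y - t)
    rw [Real.dist_eq, Real.dist_eq, ← mul_sub, abs_mul]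
    simpa using this
  have hsign : ∀ᵐ s, deriv (fun x => 6 * |x - t|) s * (stopLoss μ s - stopLoss ν s) =
      6 * |stopLoss μ s - stopLoss ν s| := by
    filter_upwards [compl_mem_ae_iff.2 (measure_singleton t)] with s hs
    rw [deriv_const_mul_field, deriv_comp_sub_const (f := abs), deriv_abs, mul_assoc]
    rcases lt_or_gt_of_ne hs with hs | hs
    · simp [hs, abs_of_nonpos (sub_nonpos.2 (hlt s hs))]
    · simp [hs, abs_of_nonneg (sub_nonneg.2 (hgt s hs))]
  rw [integral_sub_integral_eq_stopLoss hd hd' hL hμ hν hmean hsd, integral_congr_ae hsign,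
    integral_const_mul]
  ring

end SingleCrossing

lemma exists_sign_change {K : ℝ → ℝ} {a b : ℝ} (ha : ∀ s ≤ a, K s ≤ 0) (hb : ∀ s ≥ b, 0 ≤ K s)
    (hab : a ≤ b) (h : ∀ s r, s < r → 0 < K s → 0 ≤ K r) :
    ∃ t ∈ Set.Icc a b, (∀ s < t, K s ≤ 0) ∧ ∀ s > t, 0 ≤ K s := by
  have hlb : a ∈ lowerBounds ({s | 0 < K s} ∪ {b}) := by
    rintro s (hs | rfl)
    · exact le_of_not_ge fun hsa => (ha s hsa).not_gt hs
    · exact hab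
  refine ⟨sInf ({s | 0 < K s} ∪ {b}), ⟨le_csInf ⟨b, by simp⟩ hlb, csInf_le ⟨a, hlb⟩ (by simp)⟩,
    fun s hs => ?_, fun s hs => ?_⟩
  · exact not_lt.1 fun hK => notMem_of_lt_csInf hs ⟨a, hlb⟩ (Or.inl hK)
  · obtain ⟨r, hr | rfl, hrs⟩ := exists_lt_of_csInf_lt ⟨b, by simp⟩ hs
    · exact h r s hrs hr
    · exact hb s hrs.le

lemma nonneg_of_concaveOn_deriv {K k : ℝ → ℝ} (hK : ∀ s, HasDerivAt K (k s) s)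
    (hk : ConcaveOn ℝ Set.univ k) {a b : ℝ} (ha : K a ≤ 0) (hb : 0 ≤ K b) {s r : ℝ} (has : a ≤ s)
    (hsr : s < r) (hrb : r ≤ b) (hs : 0 < K s) : 0 ≤ K r := by
  by_contra! hr
  have hmvt : ∀ {u v : ℝ}, u < v → ∃ w ∈ Set.Ioo u v, k w = (K v - K u) / (v - u) := fun huv =>
    exists_hasDerivAt_eq_slope K k huv (fun x _ => (hK x).continuousAt.continuousWithinAt)
      fun x _ => hK x
  have has : a < s := has.lt_of_ne (by rintro rfl; linarith)
  have hrb : r < b := hrb.lt_of_ne (by rintro rfl; linarith)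
  obtain ⟨u, hu, hku⟩ := hmvt has
  obtain ⟨v, hv, hkv⟩ := hmvt hsr
  obtain ⟨w, hw, hkw⟩ := hmvt hrb
  have hku : 0 < k u := hku ▸ div_pos (by linarith) (by linarith)
  have hkv : k v < 0 := hkv ▸ div_neg_of_neg_of_pos (by linarith) (by linarith)
  have hkw : 0 < k w := hkw ▸ div_pos (by linarith) (by linarith)
  have hmin := hk.min_le_of_mem_Icc (Set.mem_univ u) (Set.mem_univ w)
    ⟨(hu.2.trans hv.1).le, (hv.2.trans hw.1).le⟩
  exact (lt_min hku hkw).not_ge (hmin.trans hkv.le)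

lemma stdDev_nonneg (P : Measure ℝ) : 0 ≤ stdDev P :=
  Real.sqrt_nonneg _

section Affine

variable {μ : Measure ℝ} [IsProbabilityMeasure μ]

lemma memLp_id_map_affine (hμ : MemLp id 3 μ) (s z : ℝ) :
    MemLp id 3 (μ.map fun x => s * x + z) := by
  rw [memLp_map_measure_iff (by fun_prop) (by fun_prop)]
  exact (hμ.const_mul s).add (memLp_const z)

lemma mean_map_affine (hμ : MemLp id 3 μ) (s z : ℝ) :
    mean (μ.map fun x => s * x + z) = s * mean μ + z := by
  rw [mean, integral_map (by fun_prop) (by fun_prop)]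
  simpa [add_comm] using integral_quadratic hμ z s 0

lemma stdDev_map_affine (hμ : MemLp id 3 μ) (s z : ℝ) :
    stdDev (μ.map fun x => s * x + z) = |s| * stdDev μ := by
  rw [← sq_eq_sq₀ (stdDev_nonneg _) (mul_nonneg (abs_nonneg _) (stdDev_nonneg _)), mul_pow, sq_abs,
    stdDev_sq, mean_map_affine hμ, integral_map (by fun_prop) (by fun_prop), stdDev_sq,
    ← integral_const_mul]
  congr with x
  ring

end Affine

instance isProbabilityMeasure_symmTwoPoint (s : ℝ) : IsProbabilityMeasure (symmTwoPoint s) where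
  measure_univ := by
    simp only [symmTwoPoint, Measure.smul_apply, Measure.add_apply, measure_univ, smul_eq_mul]
    rw [one_add_one_eq_two, ENNReal.inv_mul_cancel (by simp) (by simp)]

lemma integral_symmTwoPoint (s : ℝ) (f : ℝ → ℝ) :
    ∫ x, f x ∂(symmTwoPoint s) = (f (-s) + f s) / 2 := by
  rw [symmTwoPoint, integral_smul_measure,
    integral_add_measure (integrable_dirac (by simp)) (integrable_dirac (by simp)),
    integral_dirac, integral_dirac, ENNReal.toReal_inv, ENNReal.toReal_ofNat, smul_eq_mul]
  ring

lemma memLp_id_symmTwoPoint (s : ℝ) : MemLp id 3 (symmTwoPoint s) := by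
  refine MemLp.of_bound aestronglyMeasurable_id |s| (Measure.ae_smul_measure ?_ _)
  simp [ae_add_measure_iff, ae_dirac_eq]

lemma mean_symmTwoPoint (s : ℝ) : mean (symmTwoPoint s) = 0 := by
  simp [mean, integral_symmTwoPoint s fun x => x]

lemma stdDev_symmTwoPoint {s : ℝ} (hs : 0 ≤ s) : stdDev (symmTwoPoint s) = s := by
  rw [← sq_eq_sq₀ (stdDev_nonneg _) hs, stdDev_sq, mean_symmTwoPoint,
    integral_symmTwoPoint s fun x => (x - 0) ^ 2]
  ring

lemma centredThirdMoment_symmTwoPoint (s : ℝ) : centredThirdMoment (symmTwoPoint s) = 0 := by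
  rw [centredThirdMoment, mean_symmTwoPoint, integral_symmTwoPoint s fun x => (x - 0) ^ 3]
  ring

lemma stopLoss_symmTwoPoint (r s : ℝ) :
    stopLoss (symmTwoPoint r) s = (max (-r - s) 0 ^ 2 + max (r - s) 0 ^ 2) / 2 :=
  integral_symmTwoPoint r _

section StopLoss

variable {μ : Measure ℝ} [IsProbabilityMeasure μ]

lemma integrable_max_sub (hμ : MemLp id 3 μ) (s : ℝ) : Integrable (fun x => max (x - s) 0) μ := by
  simpa using (integrable_sub_pow hμ s (k := 1) (by norm_num)).pos_part

lemma hasDerivAt_stopLoss (hμ : MemLp id 3 μ) (s : ℝ) :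
    HasDerivAt (stopLoss μ) (-2 * ∫ x, max (x - s) 0 ∂μ) s := by
  have hd : ∀ x r : ℝ, HasDerivAt (fun r => max (x - r) 0 ^ 2) (-2 * max (x - r) 0) r := fun x r =>
    ((hasDerivAt_max_zero_sq (x - r)).comp_const_sub x r).congr_deriv (by ring)
  have hbound : ∀ x, ∀ r ∈ Metric.ball s 1, ‖-2 * max (x - r) 0‖ ≤ 2 * max (x - (s - 1)) 0 := by
    intro x r hr
    rw [Real.ball_eq_Ioo] at hr
    rw [norm_mul, Real.norm_of_nonneg (le_max_right _ _), norm_neg, Real.norm_two]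
    gcongr
    exact hr.1.le
  rw [← integral_const_mul]
  exact (hasDerivAt_integral_of_dominated_loc_of_deriv_le (Metric.ball_mem_nhds s one_pos)
    (.of_forall fun r => (integrable_max_sub_sq hμ r).aestronglyMeasurable)
    (integrable_max_sub_sq hμ s) (by fun_prop) (.of_forall hbound)
    ((integrable_max_sub hμ _).const_mul 2) (.of_forall fun x r _ => hd x r)).2

lemma convexOn_integral_max_sub (hμ : MemLp id 3 μ) :
    ConvexOn ℝ Set.univ fun s => ∫ x, max (x - s) 0 ∂μ := by
  refine ⟨convex_univ, fun s _ r _ a b ha hb hab => ?_⟩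
  simp only [smul_eq_mul]
  rw [← integral_const_mul, ← integral_const_mul, ← integral_add
    ((integrable_max_sub hμ s).const_mul a) ((integrable_max_sub hμ r).const_mul b)]
  refine integral_mono (integrable_max_sub hμ _) (((integrable_max_sub hμ s).const_mul a).add
    ((integrable_max_sub hμ r).const_mul b)) fun x => max_le ?_ (by positivity)
  calc x - (a * s + b * r) = a * (x - s) + b * (x - r) := by linear_combination -x * hab
    _ ≤ a * max (x - s) 0 + b * max (x - r) 0 := by gcongr <;> exact le_max_left _ _

lemma stopLoss_nonneg (μ : Measure ℝ) (s : ℝ) : 0 ≤ stopLoss μ s :=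
  integral_nonneg fun _ => sq_nonneg _

lemma stopLoss_le (hμ : MemLp id 3 μ) (s : ℝ) :
    stopLoss μ s ≤ stdDev μ ^ 2 + (mean μ - s) ^ 2 := by
  rw [← integral_sub_sq hμ]
  refine integral_mono (integrable_max_sub_sq hμ s) (integrable_sub_pow hμ s (by norm_num))
    fun x => ?_
  rcases le_total (x - s) 0 with h | h
  · simpa [h] using sq_nonneg (x - s)
  · simp [h]

end StopLoss

/-- The centred laws of unit variance with finite third absolute moment. -/
structure IsStandardLaw (μ : Measure ℝ) : Prop where
  isProbabilityMeasure : IsProbabilityMeasure μ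
  memLp_id : MemLp id 3 μ
  mean_eq : mean μ = 0
  stdDev_eq : stdDev μ = 1

lemma isStandardLaw_symmTwoPoint_one : IsStandardLaw (symmTwoPoint 1) :=
  ⟨inferInstance, memLp_id_symmTwoPoint 1, mean_symmTwoPoint 1, stdDev_symmTwoPoint zero_le_one⟩

section StandardLaw

variable {μ : Measure ℝ}

lemma isStandardLaw_map_affine [IsProbabilityMeasure μ] (hμ : MemLp id 3 μ) {s z : ℝ}
    (hmean : s * mean μ + z = 0) (hsd : |s| * stdDev μ = 1) :
    IsStandardLaw (μ.map fun x => s * x + z) :=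
  ⟨Measure.isProbabilityMeasure_map (by fun_prop), memLp_id_map_affine hμ s z,
    (mean_map_affine hμ s z).trans hmean, (stdDev_map_affine hμ s z).trans hsd⟩

lemma IsStandardLaw.map_neg (h : IsStandardLaw μ) : IsStandardLaw (μ.map fun x => -x) := by
  have := h.isProbabilityMeasure
  simpa using isStandardLaw_map_affine h.memLp_id (s := -1) (z := 0) (by simp [h.mean_eq])
    (by simp [h.stdDev_eq])

lemma IsStandardLaw.stopLoss_le_symmTwoPoint (h : IsStandardLaw μ) {s : ℝ} (hs : s ≤ -1) :
    stopLoss μ s ≤ stopLoss (symmTwoPoint 1) s := by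
  have := h.isProbabilityMeasure
  calc stopLoss μ s ≤ 1 ^ 2 + (0 - s) ^ 2 := by
        simpa only [h.mean_eq, h.stdDev_eq] using stopLoss_le h.memLp_id s
    _ = stopLoss (symmTwoPoint 1) s := by
        rw [stopLoss_symmTwoPoint, max_eq_left (by linarith), max_eq_left (by linarith)]
        ring

lemma stopLoss_symmTwoPoint_of_le {s : ℝ} (hs : 1 ≤ s) : stopLoss (symmTwoPoint 1) s = 0 := by
  rw [stopLoss_symmTwoPoint, max_eq_right (by linarith), max_eq_right (by linarith)]
  ring

lemma stopLoss_symmTwoPoint_of_mem_Icc {s : ℝ} (hs : s ∈ Set.Icc (-1) 1) :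
    stopLoss (symmTwoPoint 1) s = (1 - s) ^ 2 / 2 := by
  rw [stopLoss_symmTwoPoint, max_eq_right (by linarith [hs.1]), max_eq_left (by linarith [hs.2])]
  ring

lemma IsStandardLaw.nonneg_stopLoss_sub (h : IsStandardLaw μ) {s r : ℝ} (hs : -1 ≤ s) (hsr : s < r)
    (hr : r ≤ 1) (hpos : 0 < stopLoss μ s - stopLoss (symmTwoPoint 1) s) :
    0 ≤ stopLoss μ r - stopLoss (symmTwoPoint 1) r := by
  have := h.isProbabilityMeasure
  have hK : ∀ s, HasDerivAt (fun s => stopLoss μ s - (1 - s) ^ 2 / 2)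
      (-2 * ∫ x, max (x - s) 0 ∂μ + (1 - s)) s := fun s =>
    ((hasDerivAt_stopLoss h.memLp_id s).sub
      ((((hasDerivAt_id s).const_sub 1).fun_pow 2).div_const 2)).congr_deriv (by norm_num; ring)
  have hk : ConcaveOn ℝ Set.univ fun s => -2 * ∫ x, max (x - s) 0 ∂μ + (1 - s) := by
    have hlin : ConcaveOn ℝ Set.univ fun s : ℝ => 1 - s :=
      (concaveOn_const 1 convex_univ).sub (convexOn_id convex_univ)
    simpa [Pi.add_def, Pi.neg_def] using
      ((convexOn_integral_max_sub h.memLp_id).smul zero_le_two).neg.add hlin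
  have ha := h.stopLoss_le_symmTwoPoint le_rfl
  rw [stopLoss_symmTwoPoint_of_mem_Icc (by simp)] at ha
  rw [stopLoss_symmTwoPoint_of_mem_Icc ⟨hs, hsr.le.trans hr⟩] at hpos
  rw [stopLoss_symmTwoPoint_of_mem_Icc ⟨hs.trans hsr.le, hr⟩]
  exact nonneg_of_concaveOn_deriv hK hk (sub_nonpos.2 ha) (by simpa using stopLoss_nonneg μ 1)
    hs hsr hr hpos

lemma IsStandardLaw.exists_stopLoss_sign_change (h : IsStandardLaw μ) :
    ∃ t ∈ Set.Icc (-1 : ℝ) 1, (∀ s < t, stopLoss μ s ≤ stopLoss (symmTwoPoint 1) s) ∧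
      ∀ s > t, stopLoss (symmTwoPoint 1) s ≤ stopLoss μ s := by
  have hle : ∀ s ≤ -1, stopLoss μ s - stopLoss (symmTwoPoint 1) s ≤ 0 := fun s hs =>
    sub_nonpos.2 (h.stopLoss_le_symmTwoPoint hs)
  have hge : ∀ s ≥ 1, 0 ≤ stopLoss μ s - stopLoss (symmTwoPoint 1) s := fun s hs => by
    simpa [stopLoss_symmTwoPoint_of_le hs] using stopLoss_nonneg μ s
  have hcross : ∀ s r, s < r → 0 < stopLoss μ s - stopLoss (symmTwoPoint 1) s →
      0 ≤ stopLoss μ r - stopLoss (symmTwoPoint 1) r := fun s r hsr hpos => by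
    rcases le_total 1 r with hr | hr
    · exact hge r hr
    · exact h.nonneg_stopLoss_sub (not_lt.1 fun hs => (hle s hs.le).not_gt hpos) hsr hr hpos
  simpa only [sub_nonpos, sub_nonneg] using exists_sign_change hle hge (by norm_num) hcross

end StandardLaw

/-! ### The moment inequality -/

/-- The function `x ↦ 2 (x₊³ - (x - t)₊³)`. Up to a quadratic polynomial in `x` it is equal to
`|x|³ - |x - t|³`, and for `0 ≤ t` it vanishes on the negative half-line. -/
def cubeIncrement (t x : ℝ) : ℝ := 2 * (max x 0 ^ 3 - max (x - t) 0 ^ 3)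

lemma abs_sub_pow_three_eq (t x : ℝ) :
    |x - t| ^ 3 = |x| ^ 3 + (t ^ 3 + -(3 * t ^ 2) * x + 3 * t * x ^ 2) - cubeIncrement t x := by
  have habs : ∀ y : ℝ, |y| ^ 3 = 2 * max y 0 ^ 3 - y ^ 3 := fun y => by
    rcases le_total y 0 with hy | hy
    · rw [abs_of_nonpos hy, max_eq_right hy]
      ring
    · rw [abs_of_nonneg hy, max_eq_left hy]
      ring
  rw [habs, habs, cubeIncrement]
  ring

lemma cubeIncrement_mono (x : ℝ) : Monotone fun t => cubeIncrement t x := fun t r htr => by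
  have : max (x - r) 0 ^ 3 ≤ max (x - t) 0 ^ 3 := by gcongr
  simp only [cubeIncrement]
  linarith

lemma cubeIncrement_of_nonpos {t x : ℝ} (ht : 0 ≤ t) (hx : x ≤ 0) : cubeIncrement t x = 0 := by
  simp [cubeIncrement, hx, (show x - t ≤ 0 by linarith)]

lemma cubeIncrement_of_le {t x : ℝ} (hx : 0 ≤ x) (hxt : x ≤ t) :
    cubeIncrement t x = 2 * x ^ 3 := by
  simp [cubeIncrement, hx, hxt]

lemma cubeIncrement_of_ge {t x : ℝ} (ht : 0 ≤ t) (htx : t ≤ x) :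
    cubeIncrement t x = 2 * (x ^ 3 - (x - t) ^ 3) := by
  rw [cubeIncrement, max_eq_left (ht.trans htx), max_eq_left (sub_nonneg.2 htx)]

/-- The parabola touches the right-hand side at `-1 / c` by its form and at `c` by `hlin` and
`hquad`; these are the atoms of the extremal two-point law. -/
lemma quadratic_le_cubeIncrement_add {c t m α : ℝ} (hc : 0 < c) (ht : 0 ≤ t) (htc : t ≤ c)
    (hm : 0 ≤ m) (hα : 0 ≤ α)
    (hlin : 2 * α * c * (c ^ 2 + 1) = m * (c ^ 4 + 1) + (6 * t ^ 2 * c ^ 2 - 4 * t ^ 3 * c))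
    (hquad : α * (1 - c ^ 4) = 6 * t * c ^ 2 - 2 * t ^ 3 - 2 * m * c * (1 - c ^ 2)) (x : ℝ) :
    -α + (m / c ^ 2 - 2 * c * α) * x + (2 * m / c - c ^ 2 * α) * x ^ 2 ≤
      cubeIncrement t x + m * |x| ^ 3 := by
  rcases le_total x 0 with hx | hx
  · have hfac : 0 ≤ (c * x + 1) ^ 2 * (α + m / c ^ 2 * -x) := by
      have := neg_nonneg.2 hx
      positivity
    rw [cubeIncrement_of_nonpos ht hx, abs_of_nonpos hx]
    refine sub_nonneg.1 (hfac.trans_eq ?_)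
    field_simp
    ring
  have hfac : 0 ≤ (1 - x / c) ^ 2 * (α + m * c ^ 2 * x) := by positivity
  have hexpand : (1 - x / c) ^ 2 * (α + m * c ^ 2 * x) + 2 * t ^ 3 * (1 - x / c) ^ 2 =
      6 * t * x ^ 2 - 6 * t ^ 2 * x + 2 * t ^ 3 + m * x ^ 3 -
        (-α + (m / c ^ 2 - 2 * c * α) * x + (2 * m / c - c ^ 2 * α) * x ^ 2) := by
    field_simp
    linear_combination x ^ 2 * hquad - x * hlin
  rw [abs_of_nonneg hx]
  rcases le_total t x with htx | hxt
  · have : 0 ≤ 2 * t ^ 3 * (1 - x / c) ^ 2 := by positivity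
    rw [cubeIncrement_of_ge ht htx]
    linarith
  · have hcube : (t - x) ^ 3 ≤ t ^ 3 * (1 - x / c) ^ 2 := by
      have hle : t - x ≤ t * (1 - x / c) := by
        rw [mul_sub, mul_one, mul_div_left_comm]
        gcongr
        exact mul_le_of_le_one_right hx ((div_le_one hc).2 htc)
      calc (t - x) ^ 3 = (t - x) ^ 2 * (t - x) := by ring
        _ ≤ (t * (1 - x / c)) ^ 2 * t := by
            gcongr
            linarith
        _ = t ^ 3 * (1 - x / c) ^ 2 := by ring
    rw [cubeIncrement_of_le hx hxt]
    linarith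

lemma exists_tangent_coefficients {c t : ℝ} (hc : 0 < c) (hc1 : c < 1) (ht : 0 ≤ t) (htc : t ≤ c) :
    ∃ m α : ℝ, 0 ≤ m ∧ 0 ≤ α ∧
      2 * α * c * (c ^ 2 + 1) = m * (c ^ 4 + 1) + (6 * t ^ 2 * c ^ 2 - 4 * t ^ 3 * c) ∧
      α * (1 - c ^ 4) = 6 * t * c ^ 2 - 2 * t ^ 3 - 2 * m * c * (1 - c ^ 2) := by
  have hc2 : 0 < 1 - c ^ 2 := by nlinarith
  have hm : 0 ≤ 2 * c - t := by linarith
  have hmα : 0 ≤ 3 * c - 2 * t := by linarith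
  have hα : 0 ≤ 3 * c ^ 2 - t ^ 2 := by nlinarith
  -- The solution of the linear system, with numerators written as sums of nonnegative terms.
  refine ⟨2 * c ^ 2 * t * (1 + c ^ 2) * (3 * (2 * c - t) + t * c * (3 * c - 2 * t)) /
      ((1 - c ^ 2) * (1 + c ^ 2) * (1 + 4 * c ^ 2 + c ^ 4)),
    2 * t * ((3 * c ^ 2 - t ^ 2) + 2 * c ^ 2 * t * (3 * c - 2 * t) + 3 * c ^ 4 * (c - t) ^ 2) /
      ((1 - c ^ 2) * (1 + c ^ 2) * (1 + 4 * c ^ 2 + c ^ 4)), ?_, ?_, ?_, ?_⟩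
  · positivity
  · positivity
  · field_simp
    ring
  · field_simp
    ring

lemma exists_quadratic_le_cubeIncrement_add {c t : ℝ} (hc : 0 < c) (hc1 : c < 1) (ht : 0 ≤ t)
    (htc : t ≤ c) :
    ∃ m a₀ a₁ a₂ : ℝ, 0 ≤ m ∧
      (∀ x, a₀ + a₁ * x + a₂ * x ^ 2 ≤ cubeIncrement t x + m * |x| ^ 3) ∧
      a₀ + a₂ = cubeIncrement t c / (1 + c ^ 2) + m * (1 / c - c + 2 * c ^ 3 / (1 + c ^ 2)) := by
  obtain ⟨m, α, hm, hα, hlin, hquad⟩ := exists_tangent_coefficients hc hc1 ht htc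
  refine ⟨m, -α, m / c ^ 2 - 2 * c * α, 2 * m / c - c ^ 2 * α, hm,
    quadratic_le_cubeIncrement_add hc ht htc hm hα hlin hquad, ?_⟩
  rw [cubeIncrement_of_ge ht htc]
  field_simp
  linear_combination c * hquad - hlin

section MomentInequality

variable {μ : Measure ℝ}

lemma integrable_cubeIncrement [IsProbabilityMeasure μ] (hμ : MemLp id 3 μ) (t : ℝ) :
    Integrable (fun x => cubeIncrement t x) μ := by
  have hmax : ∀ s, Integrable (fun x => max (x - s) 0 ^ 3) μ := fun s =>
    (integrable_abs_sub_pow hμ s le_rfl).mono' (by fun_prop) <| .of_forall fun x => by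
      rw [Real.norm_of_nonneg (by positivity)]
      gcongr
      exact max_le (le_abs_self _) (abs_nonneg _)
  simpa only [cubeIncrement, sub_zero, Pi.sub_apply] using ((hmax 0).sub (hmax t)).const_mul 2

lemma IsStandardLaw.integral_quadratic (h : IsStandardLaw μ) (a b c : ℝ) :
    ∫ x, (a + b * x + c * x ^ 2) ∂μ = a + c := by
  have := h.isProbabilityMeasure
  rw [Zolotarev.integral_quadratic h.memLp_id, h.mean_eq, h.stdDev_eq]
  ring

lemma IsStandardLaw.integral_abs_sub_pow_three (h : IsStandardLaw μ) (t : ℝ) :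
    ∫ x, |x - t| ^ 3 ∂μ =
      ∫ x, |x| ^ 3 ∂μ + (t ^ 3 + 3 * t) - ∫ x, cubeIncrement t x ∂μ := by
  have := h.isProbabilityMeasure
  have hcube : Integrable (fun x => |x| ^ 3) μ := by
    simpa using integrable_abs_sub_pow h.memLp_id 0 le_rfl
  have hquad := integrable_quadratic h.memLp_id (t ^ 3) (-(3 * t ^ 2)) (3 * t)
  have hpoly : Integrable
      (fun x => |x| ^ 3 + (t ^ 3 + -(3 * t ^ 2) * x + 3 * t * x ^ 2)) μ := hcube.add hquad
  simp_rw [abs_sub_pow_three_eq t]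
  rw [integral_sub hpoly (integrable_cubeIncrement h.memLp_id t),
    integral_add hcube hquad, h.integral_quadratic]

lemma IsStandardLaw.cubeIncrement_le_integral_of_le (h : IsStandardLaw μ) {c t : ℝ} (hc : 0 < c)
    (hc1 : c < 1) (hρ : ∫ x, |x| ^ 3 ∂μ ≤ 1 / c - c + 2 * c ^ 3 / (1 + c ^ 2)) (ht : 0 ≤ t)
    (htc : t ≤ c) : cubeIncrement t c / (1 + c ^ 2) ≤ ∫ x, cubeIncrement t x ∂μ := by
  have := h.isProbabilityMeasure
  obtain ⟨m, a₀, a₁, a₂, hm, hle, heq⟩ := exists_quadratic_le_cubeIncrement_add hc hc1 ht htc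
  have hcube : Integrable (fun x => m * |x| ^ 3) μ := by
    simpa using (integrable_abs_sub_pow h.memLp_id 0 le_rfl).const_mul m
  have hW := integrable_cubeIncrement h.memLp_id t
  have hmono := integral_mono (integrable_quadratic h.memLp_id a₀ a₁ a₂) (hW.add hcube) hle
  simp only [Pi.add_apply] at hmono
  rw [h.integral_quadratic, integral_add hW hcube, integral_const_mul, heq] at hmono
  linarith [mul_le_mul_of_nonneg_left hρ hm]

lemma IsStandardLaw.cubeIncrement_le_integral (h : IsStandardLaw μ) {c t : ℝ} (hc : 0 < c)
    (hc1 : c < 1) (hρ : ∫ x, |x| ^ 3 ∂μ ≤ 1 / c - c + 2 * c ^ 3 / (1 + c ^ 2)) (ht : 0 ≤ t) :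
    cubeIncrement t c / (1 + c ^ 2) ≤ ∫ x, cubeIncrement t x ∂μ := by
  rcases le_total t c with htc | hct
  · exact h.cubeIncrement_le_integral_of_le hc hc1 hρ ht htc
  have := h.isProbabilityMeasure
  calc cubeIncrement t c / (1 + c ^ 2) = cubeIncrement c c / (1 + c ^ 2) := by
        rw [cubeIncrement_of_le hc.le hct, cubeIncrement_of_le hc.le le_rfl]
    _ ≤ ∫ x, cubeIncrement c x ∂μ := h.cubeIncrement_le_integral_of_le hc hc1 hρ hc.le le_rfl
    _ ≤ ∫ x, cubeIncrement t x ∂μ :=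
        integral_mono (integrable_cubeIncrement h.memLp_id c)
          (integrable_cubeIncrement h.memLp_id t) fun x => cubeIncrement_mono x hct

lemma two_mul_max_sub_pow_three_le {c t : ℝ} (hc : 0 < c) (hc1 : c < 1) (ht : 0 ≤ t) (ht1 : t ≤ 1) :
    2 * max (c - t) 0 ^ 3 / (1 + c ^ 2) ≤ (1 - t) ^ 3 := by
  have hmax : max (c - t) 0 ≤ c * (1 - t) := max_le (by nlinarith) (by nlinarith)
  have hcube : 2 * c ^ 3 ≤ 1 + c ^ 2 := by nlinarith [sq_nonneg c]
  rw [div_le_iff₀ (by positivity)]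
  calc 2 * max (c - t) 0 ^ 3 ≤ 2 * (c * (1 - t)) ^ 3 := by gcongr
    _ = (1 - t) ^ 3 * (2 * c ^ 3) := by ring
    _ ≤ (1 - t) ^ 3 * (1 + c ^ 2) := by gcongr

lemma IsStandardLaw.integral_abs_sub_pow_three_le_of_le (h : IsStandardLaw μ) {c t : ℝ}
    (hc : 0 < c) (hc1 : c < 1) (hρ : ∫ x, |x| ^ 3 ∂μ ≤ 1 / c - c + 2 * c ^ 3 / (1 + c ^ 2))
    (ht : 0 ≤ t) (ht1 : t ≤ 1) :
    ∫ x, |x - t| ^ 3 ∂μ - (1 + 3 * t ^ 2) ≤ ∫ x, |x| ^ 3 ∂μ - 2 * c ^ 3 / (1 + c ^ 2) := by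
  have hW := h.cubeIncrement_le_integral hc hc1 hρ ht
  rw [cubeIncrement, max_eq_left hc.le, mul_sub, sub_div] at hW
  rw [h.integral_abs_sub_pow_three]
  linarith [two_mul_max_sub_pow_three_le hc hc1 ht ht1]

lemma IsStandardLaw.integral_abs_sub_pow_three_le_of_nonneg (h : IsStandardLaw μ) {t : ℝ}
    (ht : 0 ≤ t) (ht1 : t ≤ 1) :
    ∫ x, |x - t| ^ 3 ∂μ ≤ 1 + 3 * t ^ 2 + B (∫ x, |x| ^ 3 ∂μ) := by
  by_contra! hlt
  have hB : 0 ≤ B (∫ x, |x| ^ 3 ∂μ) := Real.sqrt_nonneg _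
  obtain ⟨c, hc, hc1, hcM⟩ :=
    exists_inv_sub_eq (b := ∫ x, |x - t| ^ 3 ∂μ - (1 + 3 * t ^ 2)) (by linarith)
  rcases lt_or_ge (∫ x, |x| ^ 3 ∂μ) (1 / c - c + 2 * c ^ 3 / (1 + c ^ 2)) with hρ | hρ
  · linarith [h.integral_abs_sub_pow_three_le_of_le hc hc1 hρ.le ht ht1]
  · have hρc : 0 ≤ 1 / c - c + 2 * c ^ 3 / (1 + c ^ 2) := by
      rw [hcM]
      have : 0 ≤ 2 * c ^ 3 / (1 + c ^ 2) := by positivity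
      linarith
    have hBρ := B_mono hρc (hρc.trans hρ) hρ
    rw [B_inv_sub_add hc hc1.le] at hBρ
    linarith

lemma IsStandardLaw.integral_abs_sub_pow_three_le (h : IsStandardLaw μ) {t : ℝ}
    (ht : t ∈ Set.Icc (-1) 1) :
    ∫ x, |x - t| ^ 3 ∂μ ≤ 1 + 3 * t ^ 2 + B (∫ x, |x| ^ 3 ∂μ) := by
  rcases le_total 0 t with ht0 | ht0
  · exact h.integral_abs_sub_pow_three_le_of_nonneg ht0 ht.2
  have hneg := h.map_neg.integral_abs_sub_pow_three_le_of_nonneg (t := -t) (by linarith)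
    (by linarith [ht.1])
  rw [integral_map (by fun_prop) (by fun_prop), integral_map (by fun_prop) (by fun_prop)] at hneg
  simpa only [neg_sub_neg, abs_neg, abs_sub_comm t, neg_sq] using hneg

end MomentInequality

/-! ### The Zolotarev distance -/

section F3Bdd

variable {f : ℝ → ℝ}

lemma hasDerivAt_of_mem_F3Bdd (hf : f ∈ F3Bdd) (x : ℝ) : HasDerivAt f (deriv f x) x :=
  (hf.1.differentiable two_ne_zero x).hasDerivAt

lemma hasDerivAt_deriv_of_mem_F3Bdd (hf : f ∈ F3Bdd) (x : ℝ) :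
    HasDerivAt (deriv f) (iteratedDeriv 2 f x) x := by
  rw [iteratedDeriv_succ, iteratedDeriv_one]
  exact ((hf.1.deriv' (n := 1)).differentiable one_ne_zero x).hasDerivAt

lemma mem_F3Bdd_of_hasDerivAt {f' f'' : ℝ → ℝ} (hf : ∀ x, HasDerivAt f (f' x) x)
    (hf' : ∀ x, HasDerivAt f' (f'' x) x) (hL : LipschitzWith 1 f'') (hb : ∃ C, ∀ x, |f x| ≤ C) :
    f ∈ F3Bdd := by
  have e : deriv f = f' := funext fun x => (hf x).deriv
  have e' : deriv f' = f'' := funext fun x => (hf' x).deriv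
  refine ⟨(contDiff_succ_iff_deriv (n := 1)).2 ⟨fun x => (hf x).differentiableAt, by simp, ?_⟩,
    ?_, hb⟩
  · rw [e, contDiff_one_iff_deriv, e']
    exact ⟨fun x => (hf' x).differentiableAt, hL.continuous⟩
  · rwa [iteratedDeriv_succ, iteratedDeriv_one, e, e']

lemma integrable_of_mem_F3Bdd (hf : f ∈ F3Bdd) (μ : Measure ℝ) [IsFiniteMeasure μ] :
    Integrable f μ := by
  obtain ⟨C, hC⟩ := hf.2.2
  exact .of_bound hf.1.continuous.aestronglyMeasurable C (.of_forall hC)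

lemma comp_affine_mem_F3Bdd (hf : f ∈ F3Bdd) {s : ℝ} (hs : s ≠ 0) (z : ℝ) :
    (fun x => (|s| ^ 3)⁻¹ * f (s * x + z)) ∈ F3Bdd := by
  have : 0 < |s| := abs_pos.2 hs
  have hd : ∀ x, HasDerivAt (fun x => s * x + z) s x := fun x => by
    simpa using ((hasDerivAt_id x).const_mul s).add_const z
  refine mem_F3Bdd_of_hasDerivAt
    (fun x => ((hasDerivAt_of_mem_F3Bdd hf (s * x + z)).comp x (hd x)).const_mul _)
    (fun x => (((hasDerivAt_deriv_of_mem_F3Bdd hf (s * x + z)).comp x (hd x)).mul_const s).const_mul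
      _) (.of_dist_le_mul fun x y => ?_) ?_
  · have hL : |iteratedDeriv 2 f (s * x + z) - iteratedDeriv 2 f (s * y + z)| ≤ |s| * |x - y| := by
      simpa [Real.dist_eq, ← mul_sub, abs_mul] using hf.2.1.dist_le_mul (s * x + z) (s * y + z)
    rw [Real.dist_eq, Real.dist_eq, ← mul_sub, ← sub_mul, ← sub_mul, abs_mul, abs_mul, abs_mul,
      abs_of_pos (by positivity)]
    calc _ ≤ (|s| ^ 3)⁻¹ * (|s| * |x - y| * |s| * |s|) := by gcongr
      _ = 1 * |x - y| := by field_simp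
  · obtain ⟨C, hC⟩ := hf.2.2
    refine ⟨(|s| ^ 3)⁻¹ * C, fun x => ?_⟩
    rw [abs_mul, abs_of_pos (by positivity)]
    gcongr
    exact hC _

lemma comp_const_add_mem_F3Bdd (hf : f ∈ F3Bdd) (z : ℝ) : (fun x => f (z + x)) ∈ F3Bdd := by
  simpa [add_comm] using comp_affine_mem_F3Bdd hf one_ne_zero z

end F3Bdd

section Zeta3

variable {μ ν ξ η : Measure ℝ}

lemma le_zeta3 {f : ℝ → ℝ} (hf : f ∈ F3Bdd) (μ ν : Measure ℝ) :
    ENNReal.ofReal |∫ x, f x ∂μ - ∫ x, f x ∂ν| ≤ zeta3 μ ν :=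
  le_iSup₂ (f := fun g (_ : g ∈ F3Bdd) => ENNReal.ofReal |∫ x, g x ∂μ - ∫ x, g x ∂ν|) f hf

lemma zeta3_triangle (μ ν ξ : Measure ℝ) : zeta3 μ ξ ≤ zeta3 μ ν + zeta3 ν ξ := by
  refine iSup₂_le fun f hf => ?_
  calc ENNReal.ofReal |∫ x, f x ∂μ - ∫ x, f x ∂ξ|
      ≤ ENNReal.ofReal (|∫ x, f x ∂μ - ∫ x, f x ∂ν| + |∫ x, f x ∂ν - ∫ x, f x ∂ξ|) :=
        ENNReal.ofReal_le_ofReal (abs_sub_le _ _ _)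
    _ ≤ ENNReal.ofReal |∫ x, f x ∂μ - ∫ x, f x ∂ν| + ENNReal.ofReal |∫ x, f x ∂ν - ∫ x, f x ∂ξ| :=
        ENNReal.ofReal_add_le
    _ ≤ zeta3 μ ν + zeta3 ν ξ := add_le_add (le_zeta3 hf μ ν) (le_zeta3 hf ν ξ)

lemma zeta3_map_const_mul_le {s : ℝ} (hs : s ≠ 0) :
    zeta3 (μ.map fun x => s * x) (ν.map fun x => s * x) ≤ ENNReal.ofReal (|s| ^ 3) * zeta3 μ ν := by
  have hs' : 0 < |s| ^ 3 := pow_pos (abs_pos.2 hs) 3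
  refine iSup₂_le fun f hf => ?_
  have hmap : ∀ ξ : Measure ℝ,
      ∫ x, f x ∂(ξ.map fun x => s * x) = |s| ^ 3 * ∫ x, (|s| ^ 3)⁻¹ * f (s * x) ∂ξ := fun ξ => by
    rw [integral_map (by fun_prop) hf.1.continuous.aestronglyMeasurable, integral_const_mul,
      mul_inv_cancel_left₀ hs'.ne']
  rw [hmap, hmap, ← mul_sub, abs_mul, abs_of_pos hs', ENNReal.ofReal_mul hs'.le]
  gcongr
  exact le_zeta3 (by simpa using comp_affine_mem_F3Bdd hf hs 0) μ ν

lemma zeta3_conv_left_le [IsProbabilityMeasure ξ] [IsProbabilityMeasure μ]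
    [IsProbabilityMeasure ν] : zeta3 (ξ.conv μ) (ξ.conv ν) ≤ zeta3 μ ν := by
  refine iSup₂_le fun f hf => ?_
  have hint : ∀ (η : Measure ℝ) [IsProbabilityMeasure η],
      Integrable (fun x => ∫ y, f (x + y) ∂η) ξ := fun η _ =>
    ((integrable_map_measure hf.1.continuous.aestronglyMeasurable (by fun_prop)).1
      (integrable_of_mem_F3Bdd hf (ξ.conv η))).integral_prod_left
  rw [integral_conv (integrable_of_mem_F3Bdd hf _), integral_conv (integrable_of_mem_F3Bdd hf _),
    ← integral_sub (hint μ) (hint ν), ← Real.enorm_eq_ofReal_abs]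
  calc ‖∫ x, (∫ y, f (x + y) ∂μ - ∫ y, f (x + y) ∂ν) ∂ξ‖ₑ
      ≤ ∫⁻ x, ‖∫ y, f (x + y) ∂μ - ∫ y, f (x + y) ∂ν‖ₑ ∂ξ := enorm_integral_le_lintegral_enorm _
    _ ≤ ∫⁻ _, zeta3 μ ν ∂ξ := lintegral_mono fun x => by
        rw [Real.enorm_eq_ofReal_abs]
        exact le_zeta3 (comp_const_add_mem_F3Bdd hf x) μ ν
    _ = zeta3 μ ν := by simp

lemma zeta3_conv_le [IsProbabilityMeasure μ] [IsProbabilityMeasure ν] [IsProbabilityMeasure ξ]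
    [IsProbabilityMeasure η] : zeta3 (μ.conv ξ) (ν.conv η) ≤ zeta3 μ ν + zeta3 ξ η := by
  have hμν : zeta3 (μ.conv ξ) (ν.conv ξ) ≤ zeta3 μ ν := by
    rw [Measure.conv_comm μ, Measure.conv_comm ν]
    exact zeta3_conv_left_le
  exact (zeta3_triangle _ (ν.conv ξ) _).trans (add_le_add hμν zeta3_conv_left_le)

lemma zeta3_convFin_le {n : ℕ} {P Q : Fin n → Measure ℝ} [∀ i, IsProbabilityMeasure (P i)]
    [∀ i, IsProbabilityMeasure (Q i)] :
    zeta3 (convFin n P) (convFin n Q) ≤ ∑ i, zeta3 (P i) (Q i) := by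
  induction n with
  | zero => simp [convFin, zeta3]
  | succ n ih =>
    rw [Fin.sum_univ_succ]
    exact zeta3_conv_le.trans (add_le_add le_rfl ih)

end Zeta3

lemma integral_abs_sub_pow_three_symmTwoPoint {t : ℝ} (ht : t ∈ Set.Icc (-1) 1) :
    ∫ x, |x - t| ^ 3 ∂(symmTwoPoint 1) = 1 + 3 * t ^ 2 := by
  rw [integral_symmTwoPoint 1 fun x => |x - t| ^ 3, abs_of_nonpos (by linarith [ht.1]),
    abs_of_nonneg (by linarith [ht.2])]
  ring

lemma IsStandardLaw.zeta3_symmTwoPoint_le {μ : Measure ℝ} (h : IsStandardLaw μ) :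
    zeta3 μ (symmTwoPoint 1) ≤ ENNReal.ofReal (B (∫ x, |x| ^ 3 ∂μ) / 6) := by
  have := h.isProbabilityMeasure
  obtain ⟨-, hν, hν_mean, hν_sd⟩ := isStandardLaw_symmTwoPoint_one
  have hmean := h.mean_eq.trans hν_mean.symm
  have hsd := h.stdDev_eq.trans hν_sd.symm
  obtain ⟨t, ht, hlt, hgt⟩ := h.exists_stopLoss_sign_change
  refine iSup₂_le fun f hf => ENNReal.ofReal_le_ofReal ?_
  calc |∫ x, f x ∂μ - ∫ x, f x ∂(symmTwoPoint 1)|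
      ≤ (∫ s, |stopLoss μ s - stopLoss (symmTwoPoint 1) s|) / 2 :=
        abs_integral_sub_integral_le_stopLoss (hasDerivAt_of_mem_F3Bdd hf)
          (hasDerivAt_deriv_of_mem_F3Bdd hf) hf.2.1 h.memLp_id hν hmean hsd
    _ = (∫ x, |x - t| ^ 3 ∂μ - (1 + 3 * t ^ 2)) / 6 := by
        rw [integral_abs_stopLoss_sub h.memLp_id hν hmean hsd hlt hgt,
          integral_abs_sub_pow_three_symmTwoPoint ht]
        ring
    _ ≤ B (∫ x, |x| ^ 3 ∂μ) / 6 := by linarith [h.integral_abs_sub_pow_three_le ht]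

/-! ### The upper bound -/

lemma map_affine_conv {μ ν : Measure ℝ} [SFinite μ] [SFinite ν] (s a b : ℝ) :
    (μ.conv ν).map (fun x => s * x + (a + b)) =
      (μ.map fun x => s * x + a).conv (ν.map fun x => s * x + b) := by
  rw [Measure.conv, Measure.conv, Measure.map_prod_map μ ν (by fun_prop) (by fun_prop),
    Measure.map_map (by fun_prop) (by fun_prop), Measure.map_map (by fun_prop) (by fun_prop)]
  congr 1
  ext p
  simp only [Function.comp_apply, Prod.map]
  ring

lemma map_affine_convFin {n : ℕ} {P : Fin n → Measure ℝ} [∀ i, IsProbabilityMeasure (P i)] (s : ℝ)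
    (z : Fin n → ℝ) : (convFin n P).map (fun x => s * x + ∑ i, z i) =
      convFin n fun i => (P i).map fun x => s * x + z i := by
  induction n with
  | zero =>
    rw [convFin, convFin, Measure.map_dirac' (by fun_prop)]
    simp
  | succ n ih => rw [convFin, convFin, Fin.sum_univ_succ, map_affine_conv, ih]

lemma standardize_eq_map_affine (P : Measure ℝ) :
    standardize P = P.map fun x => (stdDev P)⁻¹ * x + -(mean P / stdDev P) := by
  rw [standardize]
  congr with x
  ring

lemma stdDev_convFin {n : ℕ} {P : Fin n → Measure ℝ} [∀ i, IsProbabilityMeasure (P i)]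
    (hP : ∀ i, MemLp id 3 (P i)) : stdDev (convFin n P) = √(∑ i, stdDev (P i) ^ 2) := by
  rw [← stdDev_sq_convFin hP, Real.sqrt_sq (stdDev_nonneg _)]

lemma standardize_convFin {n : ℕ} {P : Fin n → Measure ℝ} [∀ i, IsProbabilityMeasure (P i)]
    (hP : ∀ i, MemLp id 3 (P i)) (hs : ∀ i, 0 < stdDev (P i)) :
    standardize (convFin n P) = convFin n fun i =>
      (standardize (P i)).map fun x => stdDev (P i) / stdDev (convFin n P) * x := by
  set σ := stdDev (convFin n P) with hσ
  have hz : -(mean (convFin n P) / σ) = ∑ i, -(mean (P i) / σ) := by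
    rw [mean_convFin hP, Finset.sum_neg_distrib, Finset.sum_div]
  rw [standardize_eq_map_affine, ← hσ, hz, map_affine_convFin]
  congr with i : 1
  rw [standardize_eq_map_affine, Measure.map_map (by fun_prop) (by fun_prop)]
  congr with x
  have := (hs i).ne'
  simp only [Function.comp_apply]
  field_simp

namespace MemP3

variable {P : Measure ℝ}

lemma memLp_id (h : MemP3 P) : MemLp id 3 P := by
  rw [← integrable_norm_rpow_iff aestronglyMeasurable_id (by simp) (by simp)]
  simpa using h.integrable_abs_pow_three

lemma isStandardLaw_standardize (h : MemP3 P) : IsStandardLaw (standardize P) := by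
  have := h.isProbabilityMeasure
  have hs := h.stdDev_pos
  rw [standardize_eq_map_affine]
  refine isStandardLaw_map_affine h.memLp_id (by ring) ?_
  rw [abs_of_pos (inv_pos.2 hs), inv_mul_cancel₀ hs.ne']

end MemP3

lemma memP3_symmTwoPoint {s : ℝ} (hs : 0 < s) : MemP3 (symmTwoPoint s) where
  isProbabilityMeasure := inferInstance
  integrable_abs_pow_three := by
    simpa using integrable_abs_sub_pow (memLp_id_symmTwoPoint s) 0 le_rfl
  stdDev_pos := by rwa [stdDev_symmTwoPoint hs.le]

lemma standardize_symmTwoPoint {s : ℝ} (hs : 0 < s) :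
    standardize (symmTwoPoint s) = symmTwoPoint 1 := by
  rw [standardize, mean_symmTwoPoint, stdDev_symmTwoPoint hs.le, symmTwoPoint,
    Measure.map_smul, Measure.map_add _ _ (by fun_prop), Measure.map_dirac' (by fun_prop),
    Measure.map_dirac' (by fun_prop), symmTwoPoint, sub_zero, sub_zero, neg_div, div_self hs.ne']

section Convolution

variable {n : ℕ} {P Q : Fin n → Measure ℝ}

lemma memP3_convFin (hn : 1 ≤ n) (hP : ∀ i, MemP3 (P i)) : MemP3 (convFin n P) := by
  have := fun i => (hP i).isProbabilityMeasure
  have hmem := memLp_id_convFin fun i => (hP i).memLp_id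
  refine ⟨inferInstance, by simpa using integrable_abs_sub_pow hmem 0 le_rfl, ?_⟩
  rw [stdDev_convFin fun i => (hP i).memLp_id, Real.sqrt_pos]
  exact Finset.sum_pos (fun i _ => pow_pos (hP i).stdDev_pos 2) ⟨⟨0, hn⟩, Finset.mem_univ _⟩

lemma stdDev_convFin_congr (hP : ∀ i, MemP3 (P i)) (hQ : ∀ i, MemP3 (Q i))
    (hPQ : ∀ i, stdDev (P i) = stdDev (Q i)) : stdDev (convFin n P) = stdDev (convFin n Q) := by
  have := fun i => (hP i).isProbabilityMeasure
  have := fun i => (hQ i).isProbabilityMeasure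
  simp_rw [stdDev_convFin fun i => (hP i).memLp_id, stdDev_convFin fun i => (hQ i).memLp_id, hPQ]

lemma zeta3_standardize_convFin_le (hP : ∀ i, MemP3 (P i)) (hQ : ∀ i, MemP3 (Q i))
    (hPQ : ∀ i, stdDev (P i) = stdDev (Q i)) :
    zeta3 (standardize (convFin n P)) (standardize (convFin n Q)) ≤
      ∑ i, ENNReal.ofReal ((stdDev (P i) / stdDev (convFin n P)) ^ 3) *
        zeta3 (standardize (P i)) (standardize (Q i)) := by
  have := fun i => (hP i).isProbabilityMeasure
  have := fun i => (hQ i).isProbabilityMeasure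
  have hstdP := fun i => (hP i).isStandardLaw_standardize.isProbabilityMeasure
  have hstdQ := fun i => (hQ i).isStandardLaw_standardize.isProbabilityMeasure
  rw [standardize_convFin (fun i => (hP i).memLp_id) fun i => (hP i).stdDev_pos,
    standardize_convFin (fun i => (hQ i).memLp_id) fun i => (hQ i).stdDev_pos,
    ← stdDev_convFin_congr hP hQ hPQ]
  simp_rw [← hPQ]
  have hscale : ∀ {R : Measure ℝ} [IsProbabilityMeasure R] (c : ℝ),
      IsProbabilityMeasure (R.map fun x => c * x) := fun c =>
    Measure.isProbabilityMeasure_map (by fun_prop)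
  refine zeta3_convFin_le.trans (Finset.sum_le_sum fun i _ => ?_)
  have hc : 0 < stdDev (P i) / stdDev (convFin n P) :=
    div_pos (hP i).stdDev_pos (memP3_convFin (Fin.pos i) hP).stdDev_pos
  simpa only [abs_of_pos hc] using zeta3_map_const_mul_le hc.ne'

lemma zeta3_standardize_convFin_symmTwoPoint_le (hP : ∀ i, MemP3 (P i)) :
    zeta3 (standardize (convFin n P))
        (standardize (convFin n fun i => symmTwoPoint (stdDev (P i)))) ≤
      ENNReal.ofReal
        (1 / (6 * stdDev (convFin n P) ^ 3) * ∑ i, stdDev (P i) ^ 3 * B (rho (P i))) := by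
  have hs := fun i => (hP i).stdDev_pos
  have hratio : ∀ i, 0 ≤ (stdDev (P i) / stdDev (convFin n P)) ^ 3 := fun i =>
    pow_nonneg (div_nonneg (stdDev_nonneg _) (stdDev_nonneg _)) 3
  have hB : ∀ i, 0 ≤ B (rho (P i)) := fun i => Real.sqrt_nonneg _
  calc _ ≤ ∑ i, ENNReal.ofReal ((stdDev (P i) / stdDev (convFin n P)) ^ 3) *
        zeta3 (standardize (P i)) (standardize (symmTwoPoint (stdDev (P i)))) :=
        zeta3_standardize_convFin_le hP (fun i => memP3_symmTwoPoint (hs i))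
          fun i => (stdDev_symmTwoPoint (hs i).le).symm
    _ ≤ ∑ i, ENNReal.ofReal ((stdDev (P i) / stdDev (convFin n P)) ^ 3) *
        ENNReal.ofReal (B (rho (P i)) / 6) := by
        gcongr with i
        rw [standardize_symmTwoPoint (hs i)]
        exact (hP i).isStandardLaw_standardize.zeta3_symmTwoPoint_le
    _ = _ := by
        simp_rw [← ENNReal.ofReal_mul (hratio _)]
        rw [← ENNReal.ofReal_sum_of_nonneg fun i _ =>
          mul_nonneg (hratio i) (div_nonneg (hB i) (by norm_num)), Finset.mul_sum]
        congr with i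
        ring

end Convolution

/-! ### The lower bound -/

section ThirdMomentBound

variable {μ ν : Measure ℝ}

lemma neg_sin_mul_div_mem_F3Bdd {ε : ℝ} (hε : 0 < ε) :
    (fun x => -Real.sin (ε * x) / ε ^ 3) ∈ F3Bdd := by
  have hd : ∀ x, HasDerivAt (fun x => ε * x) ε x := fun x => hasDerivAt_const_mul ε
  refine mem_F3Bdd_of_hasDerivAt (f' := fun x => -Real.cos (ε * x) / ε ^ 2)
    (f'' := fun x => Real.sin (ε * x) / ε) (fun x => ?_) (fun x => ?_)
    (.of_dist_le_mul fun x y => ?_) ⟨1 / ε ^ 3, fun x => ?_⟩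
  · refine (((Real.hasDerivAt_sin (ε * x)).comp x (hd x)).neg.div_const (ε ^ 3)).congr_deriv ?_
    field_simp
  · refine (((Real.hasDerivAt_cos (ε * x)).comp x (hd x)).neg.div_const (ε ^ 2)).congr_deriv ?_
    field_simp
  · have hsin : |Real.sin (ε * x) - Real.sin (ε * y)| ≤ ε * |x - y| := by
      simpa [Real.dist_eq, ← mul_sub, abs_mul, abs_of_pos hε] using
        Real.lipschitzWith_sin.dist_le_mul (ε * x) (ε * y)
    rwa [Real.dist_eq, Real.dist_eq, NNReal.coe_one, one_mul, ← sub_div, abs_div, abs_of_pos hε,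
      div_le_iff₀' hε]
  · rw [abs_div, abs_neg, abs_of_pos (pow_pos hε 3)]
    gcongr
    exact Real.abs_sin_le_one _

lemma abs_sub_sin_div_sub_le {ε x : ℝ} (hε : 0 < ε) (hx : |ε * x| ≤ 1) :
    |(ε * x - Real.sin (ε * x)) / ε ^ 3 - x ^ 3 / 6| ≤ ε ^ 2 * |x| ^ 5 / 100 := by
  have h := Real.sin_bound hx
  have e : (ε * x - Real.sin (ε * x)) / ε ^ 3 - x ^ 3 / 6 =
      -(Real.sin (ε * x) - (ε * x - (ε * x) ^ 3 / 6)) / ε ^ 3 := by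
    field_simp
    ring
  rw [e, abs_div, abs_neg, abs_of_pos (pow_pos hε 3), div_le_iff₀ (pow_pos hε 3)]
  calc _ ≤ |ε * x| ^ 5 / 100 := h
    _ = ε ^ 2 * |x| ^ 5 / 100 * ε ^ 3 := by
      rw [abs_mul, abs_of_pos hε]
      ring

lemma tendsto_sub_sin_div (x : ℝ) :
    Filter.Tendsto (fun ε => (ε * x - Real.sin (ε * x)) / ε ^ 3) (nhdsWithin 0 (Set.Ioi 0))
      (nhds (x ^ 3 / 6)) := by
  have hbound : Filter.Tendsto (fun ε : ℝ => ε ^ 2 * |x| ^ 5 / 100) (nhdsWithin 0 (Set.Ioi 0))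
      (nhds 0) :=
    (Continuous.tendsto' (by fun_prop) _ _ (by simp)).mono_left nhdsWithin_le_nhds
  have hsmall : ∀ᶠ ε : ℝ in nhdsWithin 0 (Set.Ioi 0), |ε * x| ≤ 1 :=
    ((Continuous.tendsto' (f := fun ε : ℝ => |ε * x|) (by fun_prop) 0 0 (by simp)).mono_left
      nhdsWithin_le_nhds).eventually_le_const one_pos
  rw [tendsto_iff_norm_sub_tendsto_zero]
  refine squeeze_zero' (.of_forall fun _ => norm_nonneg _) ?_ hbound
  filter_upwards [hsmall, self_mem_nhdsWithin] with ε hx hε using abs_sub_sin_div_sub_le hε hx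

lemma tendsto_integral_sub_sin_div [IsProbabilityMeasure μ] (hμ : MemLp id 3 μ) :
    Filter.Tendsto (fun ε => ∫ x, (ε * x - Real.sin (ε * x)) / ε ^ 3 ∂μ)
      (nhdsWithin 0 (Set.Ioi 0)) (nhds ((∫ x, x ^ 3 ∂μ) / 6)) := by
  have hcube : Integrable (fun x => |x| ^ 3) μ := by
    simpa using integrable_abs_sub_pow hμ 0 le_rfl
  rw [← integral_div]
  refine tendsto_integral_filter_of_dominated_convergence (fun x => |x| ^ 3 / 6)
    (.of_forall fun ε => by fun_prop) ?_ (hcube.div_const 6) (.of_forall tendsto_sub_sin_div)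
  filter_upwards [self_mem_nhdsWithin] with ε (hε : 0 < ε)
  refine .of_forall fun x => ?_
  rw [norm_div, Real.norm_of_nonneg (pow_pos hε 3).le, div_le_iff₀ (pow_pos hε 3)]
  calc |ε * x - Real.sin (ε * x)| ≤ |ε * x| ^ 3 / 6 := Real.abs_sub_sin_le _
    _ = |x| ^ 3 / 6 * ε ^ 3 := by
      rw [abs_mul, abs_of_pos hε]
      ring

lemma integral_sub_sin_div [IsProbabilityMeasure μ] (hμ : MemLp id 3 μ) {ε : ℝ} (hε : 0 < ε) :
    ∫ x, (ε * x - Real.sin (ε * x)) / ε ^ 3 ∂μ =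
      ε * mean μ / ε ^ 3 + ∫ x, -Real.sin (ε * x) / ε ^ 3 ∂μ := by
  have hlin : Integrable (fun x => ε * x / ε ^ 3) μ := by
    simpa using ((integrable_quadratic hμ 0 ε 0).div_const (ε ^ 3))
  simp_rw [sub_eq_add_neg, add_div]
  rw [integral_add hlin (integrable_of_mem_F3Bdd (neg_sin_mul_div_mem_F3Bdd hε) μ), integral_div,
    integral_const_mul, mean]

lemma ofReal_abs_integral_pow_three_sub_le_zeta3 [IsProbabilityMeasure μ] [IsProbabilityMeasure ν]
    (hμ : MemLp id 3 μ) (hν : MemLp id 3 ν) (hmean : mean μ = mean ν) :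
    ENNReal.ofReal (|∫ x, x ^ 3 ∂μ - ∫ x, x ^ 3 ∂ν| / 6) ≤ zeta3 μ ν := by
  have hlim := ENNReal.tendsto_ofReal
    ((tendsto_integral_sub_sin_div hμ).sub (tendsto_integral_sub_sin_div hν)).abs
  rw [← sub_div, abs_div, Nat.abs_ofNat] at hlim
  refine le_of_tendsto hlim ?_
  filter_upwards [self_mem_nhdsWithin] with ε (hε : 0 < ε)
  rw [integral_sub_sin_div hμ hε, integral_sub_sin_div hν hε, hmean, add_sub_add_left_eq_sub]
  exact le_zeta3 (neg_sin_mul_div_mem_F3Bdd hε) μ ν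

lemma integral_standardize {f : ℝ → ℝ} (hf : Continuous f) (P : Measure ℝ) :
    ∫ x, f x ∂(standardize P) = ∫ x, f ((x - mean P) / stdDev P) ∂P :=
  integral_map (by fun_prop) hf.aestronglyMeasurable

lemma integral_pow_three_standardize (P : Measure ℝ) :
    ∫ x, x ^ 3 ∂(standardize P) = centredThirdMoment P / stdDev P ^ 3 := by
  rw [integral_standardize (by fun_prop), centredThirdMoment, ← integral_div]
  simp_rw [div_pow]

lemma ofReal_abs_centredThirdMoment_sub_le_zeta3 {P Q : Measure ℝ} (hP : MemP3 P) (hQ : MemP3 Q)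
    (hsd : stdDev P = stdDev Q) :
    ENNReal.ofReal (|centredThirdMoment P - centredThirdMoment Q| / (6 * stdDev P ^ 3)) ≤
      zeta3 (standardize P) (standardize Q) := by
  obtain ⟨_, hP3, hP0, -⟩ := hP.isStandardLaw_standardize
  obtain ⟨_, hQ3, hQ0, -⟩ := hQ.isStandardLaw_standardize
  have h := ofReal_abs_integral_pow_three_sub_le_zeta3 hP3 hQ3 (hP0.trans hQ0.symm)
  rwa [integral_pow_three_standardize, integral_pow_three_standardize, ← hsd, ← sub_div, abs_div,
    abs_of_pos (pow_pos hP.stdDev_pos 3), div_div, mul_comm _ (6 : ℝ)] at h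

end ThirdMomentBound

lemma rho_eq (P : Measure ℝ) : rho P = (∫ x, |x - mean P| ^ 3 ∂P) / stdDev P ^ 3 := by
  rw [rho, integral_standardize (by fun_prop), ← integral_div]
  simp_rw [abs_div, div_pow, abs_of_nonneg (stdDev_nonneg P)]

section TwoPoint

/-- The law charging `a` with probability `p` and `b` with probability `1 - p`, for `p ∈ [0, 1]`. -/
def twoPointLaw (a b p : ℝ) : Measure ℝ :=
  ENNReal.ofReal p • Measure.dirac a + ENNReal.ofReal (1 - p) • Measure.dirac b

lemma integral_twoPointLaw {p : ℝ} (hp : 0 ≤ p) (hp1 : p ≤ 1) (a b : ℝ) (f : ℝ → ℝ) :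
    ∫ x, f x ∂(twoPointLaw a b p) = p * f a + (1 - p) * f b := by
  rw [twoPointLaw, integral_add_measure
    ((integrable_dirac (by simp)).smul_measure ENNReal.ofReal_ne_top)
    ((integrable_dirac (by simp)).smul_measure ENNReal.ofReal_ne_top)]
  simp [integral_smul_measure, ENNReal.toReal_ofReal, hp, hp1]

variable {a b p : ℝ}

lemma integral_sub_mean_twoPointLaw (hp : 0 ≤ p) (hp1 : p ≤ 1) (f : ℝ → ℝ) :
    ∫ x, f (x - mean (twoPointLaw a b p)) ∂(twoPointLaw a b p) =
      p * f ((1 - p) * (a - b)) + (1 - p) * f (-(p * (a - b))) := by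
  have hm : mean (twoPointLaw a b p) = p * a + (1 - p) * b :=
    integral_twoPointLaw hp hp1 a b fun x => x
  rw [integral_twoPointLaw hp hp1 a b fun x => f (x - mean (twoPointLaw a b p)), hm]
  congr 3 <;> ring

lemma stdDev_twoPointLaw (hp : 0 ≤ p) (hp1 : p ≤ 1) :
    stdDev (twoPointLaw a b p) = √(p * (1 - p)) * |a - b| := by
  have hpq : 0 ≤ p * (1 - p) := mul_nonneg hp (sub_nonneg.2 hp1)
  rw [← sq_eq_sq₀ (stdDev_nonneg _) (by positivity), mul_pow, Real.sq_sqrt hpq, sq_abs, stdDev_sq,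
    integral_sub_mean_twoPointLaw hp hp1 fun x => x ^ 2]
  ring

lemma centredThirdMoment_twoPointLaw (hp : 0 ≤ p) (hp1 : p ≤ 1) :
    centredThirdMoment (twoPointLaw a b p) = p * (1 - p) * (1 - 2 * p) * (a - b) ^ 3 := by
  rw [centredThirdMoment, integral_sub_mean_twoPointLaw hp hp1 fun x => x ^ 3]
  ring

lemma rho_twoPointLaw (hab : a ≠ b) (hp : 0 < p) (hp1 : p < 1) :
    rho (twoPointLaw a b p) = 1 / √(p * (1 - p)) - 2 / (1 / √(p * (1 - p))) := by
  have hq : 0 < 1 - p := sub_pos.2 hp1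
  have : 0 < √(p * (1 - p)) := Real.sqrt_pos.2 (mul_pos hp hq)
  have : 0 < |a - b| := abs_pos.2 (sub_ne_zero.2 hab)
  have habs : ∫ x, |x - mean (twoPointLaw a b p)| ^ 3 ∂(twoPointLaw a b p) =
      √(p * (1 - p)) ^ 2 * (1 - 2 * √(p * (1 - p)) ^ 2) * |a - b| ^ 3 := by
    rw [integral_sub_mean_twoPointLaw hp.le hp1.le fun x => |x| ^ 3, abs_neg, abs_mul, abs_mul,
      abs_of_pos hp, abs_of_pos hq, Real.sq_sqrt (mul_pos hp hq).le]
    ring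
  rw [rho_eq, habs, stdDev_twoPointLaw hp.le hp1.le]
  field_simp

lemma B_rho_twoPointLaw (hab : a ≠ b) (hp : 0 < p) (hp1 : p < 1) :
    B (rho (twoPointLaw a b p)) = |1 - 2 * p| / √(p * (1 - p)) := by
  have hpq : 0 < p * (1 - p) := mul_pos hp (sub_pos.2 hp1)
  have hw : 0 < √(p * (1 - p)) := Real.sqrt_pos.2 hpq
  have hsq : (1 / √(p * (1 - p))) ^ 2 - 4 = ((1 - 2 * p) / √(p * (1 - p))) ^ 2 := by
    have : 1 - p ≠ 0 := (sub_pos.2 hp1).ne'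
    rw [div_pow, div_pow, Real.sq_sqrt hpq.le]
    field_simp
    ring
  rw [rho_twoPointLaw hab hp hp1, B_sub_two_div (by positivity), hsq, Real.sqrt_sq_eq_abs,
    abs_div, abs_of_pos hw]

lemma abs_centredThirdMoment_of_isTwoPoint {P : Measure ℝ} (hP : IsTwoPoint P) :
    |centredThirdMoment P| = stdDev P ^ 3 * B (rho P) := by
  obtain ⟨a, b, p, hab, hp, hp1, rfl⟩ := hP
  change |centredThirdMoment (twoPointLaw a b p)| =
    stdDev (twoPointLaw a b p) ^ 3 * B (rho (twoPointLaw a b p))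
  have hpq : 0 < p * (1 - p) := mul_pos hp (sub_pos.2 hp1)
  have : 0 < √(p * (1 - p)) := Real.sqrt_pos.2 hpq
  rw [B_rho_twoPointLaw hab hp hp1, stdDev_twoPointLaw hp.le hp1.le,
    centredThirdMoment_twoPointLaw hp.le hp1.le, abs_mul, abs_mul, abs_pow, abs_of_pos hpq]
  field_simp
  rw [Real.sq_sqrt hpq.le]
  ring

end TwoPoint

lemma abs_sum_eq_sum_abs {ι : Type*} {s : Finset ι} {f : ι → ℝ}
    (h : (∀ i ∈ s, 0 ≤ f i) ∨ ∀ i ∈ s, f i ≤ 0) : |∑ i ∈ s, f i| = ∑ i ∈ s, |f i| := by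
  rcases h with h | h
  · rw [Finset.abs_sum_of_nonneg h, Finset.sum_congr rfl fun i hi => abs_of_nonneg (h i hi)]
  · rw [abs_of_nonpos (Finset.sum_nonpos h), ← Finset.sum_neg_distrib,
      Finset.sum_congr rfl fun i hi => abs_of_nonpos (h i hi)]

lemma ofReal_sum_abs_centredThirdMoment_le_zeta3 {n : ℕ} (hn : 1 ≤ n) {P : Fin n → Measure ℝ}
    (hP : ∀ i, MemP3 (P i))
    (h : (∀ i, 0 ≤ centredThirdMoment (P i)) ∨ ∀ i, centredThirdMoment (P i) ≤ 0) :
    ENNReal.ofReal (1 / (6 * stdDev (convFin n P) ^ 3) * ∑ i, |centredThirdMoment (P i)|) ≤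
      zeta3 (standardize (convFin n P))
        (standardize (convFin n fun i => symmTwoPoint (stdDev (P i)))) := by
  have := fun i => (hP i).isProbabilityMeasure
  have hs := fun i => (hP i).stdDev_pos
  have hQ := fun i => memP3_symmTwoPoint (hs i)
  have hsd := stdDev_convFin_congr hP hQ fun i => (stdDev_symmTwoPoint (hs i).le).symm
  have hsum := abs_sum_eq_sum_abs (s := Finset.univ) (f := fun i => centredThirdMoment (P i))
    (by simpa using h)
  have hlower := ofReal_abs_centredThirdMoment_sub_le_zeta3 (memP3_convFin hn hP)
    (memP3_convFin hn hQ) hsd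
  simpa only [centredThirdMoment_convFin fun i => (hP i).memLp_id,
    centredThirdMoment_convFin fun i => (hQ i).memLp_id, centredThirdMoment_symmTwoPoint,
    Finset.sum_const_zero, sub_zero, hsum, div_eq_inv_mul, mul_one] using hlower

end

end Zolotarev

theorem theorem1p8 (n : ℕ) (hn : 1 ≤ n) (P : Fin n → Measure ℝ) (hP : ∀ i, MemP3 (P i))
    (σ : ℝ) (hσ : σ = √(∑ i, stdDev (P i) ^ 2)) :
    zeta3 (standardize (convFin n P))
        (standardize (convFin n (fun i => symmTwoPoint (stdDev (P i)))))
      ≤ ENNReal.ofReal (1 / (6 * σ ^ 3) * ∑ i, stdDev (P i) ^ 3 * B (rho (P i))) ∧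
    ((∀ i, IsTwoPoint (P i)) →
      ((∀ i, 0 ≤ centredThirdMoment (P i)) ∨ (∀ i, centredThirdMoment (P i) ≤ 0)) →
      zeta3 (standardize (convFin n P))
          (standardize (convFin n (fun i => symmTwoPoint (stdDev (P i)))))
        = ENNReal.ofReal (1 / (6 * σ ^ 3) * ∑ i, stdDev (P i) ^ 3 * B (rho (P i)))) := by
  have := fun i => (hP i).isProbabilityMeasure
  rw [← stdDev_convFin fun i => (hP i).memLp_id] at hσ
  subst hσ
  refine ⟨zeta3_standardize_convFin_symmTwoPoint_le hP, fun htwo hsign =>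
    (zeta3_standardize_convFin_symmTwoPoint_le hP).antisymm ?_⟩
  simp_rw [← abs_centredThirdMoment_of_isTwoPoint (htwo _)]
  exact ofReal_sum_abs_centredThirdMoment_le_zeta3 hn hP hsign
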